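/- **Setting.** Let $\bar u\in\mathbb R^d$, and let $C\subseteq[0,\bar u]=\{x: 0\le x\le\bar u\}$ be compact, convex and down-closed ($0\le w\le v\in C$ implies $w\in C$), with $\|x\|\le D$ for all $x\in C$. Let $(Z,\mu)$ be a $\sigma$-finite measure space, and let $p(z;x)$ and $\tilde F(x;z)$ be jointly measurable real functions such that, for every $x\in[0,\bar u]$, $p(\cdot\,;x)$ is a probability density with respect to $\mu$ and $\tilde F(x;\cdot)$ is integrable under it. Let $$F(x)=\mathbb E_{z\sim p(\cdot;x)}[\tilde F(x;z)].$$ Assume that $F\ge 0$ on $[0,\bar u]$ and that $F$ is DR-submodular (not necessarily monotone) there: $F(y+ke_i)-F(y)\le F(x+ke_i)-F(x)$ whenever $x\le y$, $k\ge0$ and all four points lie in $[0,\bar u]$. Let $\delta\ge0$, let $C_\delta=\bigcup_{c\in C}\{x:\|x-c\|\le\delta D\}$, and assume that for every $z$ the functions $\tilde F(\cdot\,;z)$ and $p(z;\cdot)$ are $C^2$ and $p>0$ on an open set containing $C_\delta$. Assume that there are constants $B,G,L,L_2$ such that for all $x\in C$ and all $z$ $$|\tilde F(x;z)|\le B,\quad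 \|\nabla\tilde F(x;z)\|\le G,\quad \mathbb E_{z\sim p(\cdot;x)}\|\nabla\log p(z;x)\|^4\le G^4,\quad \|\nabla^2\tilde F(x;z)\|\le L,\quad \mathbb E_{z\sim p(\cdot;x)}\|\nabla^2\log p(z;x)\|^2\le L^2,$$ and such that, for every $z$, $\nabla^2\tilde F(\cdot\,;z)$ and $\nabla^2\log p(z;\cdot)$ are $L_2$-Lipschitz on $C_\delta$. (All derivatives are in $x$; matrix norms are spectral norms.) Put $\bar L=(4B^2G^4+16G^4+4L^2+4B^2L^2)^{1/2}$. **Algorithm SMCG++** with $T\ge1$ steps, initial batch size $m_0\ge1$, batch size $m$ and difference parameter $\delta$. Start at $x^0=0$. For $t=0$, draw $m_0$ independent samples $z_k\sim p(\cdot\,;0)$ and set $$g^0=\frac1{m_0}\sum_k\hat g(0;z_k),\qquad \hat g(x;z)=\nabla\tilde F(x;z)+\tilde F(x;z)\nabla\log p(z;x).$$ For $1\le t\le T-1$, put $u=x^t-x^{t-1}$; draw, conditionally on the past, $m$ independent pairs $(a_k,z_k)$ with $a_k$ uniform on $[0,1]$ and, given $a_k$, $z_k\sim p(\cdot\,;y_k)$,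 where $y_k=a_kx^t+(1-a_k)x^{t-1}$; and set $g^t=g^{t-1}+\frac1m\sum_k\hat h(y_k;z_k)$. Here $\hat h(y;z)$ is the product $\tilde\nabla^2F(y;z)\,u$ with the Hessian estimator $$\tilde\nabla^2F(y;z)=\tilde F\,(\nabla\log p)(\nabla\log p)^\top+(\nabla\log p)(\nabla\tilde F)^\top+(\nabla\tilde F)(\nabla\log p)^\top+\nabla^2\tilde F+\tilde F\,\nabla^2\log p\quad\text{at }(y;z),$$ in which, if $\delta>0$, the two products $\nabla^2\psi(y)u$ ($\psi=\tilde F(\cdot\,;z)$ and $\psi=\log p(z;\cdot)$) are replaced by $\frac{\nabla\psi(y+\delta u)-\nabla\psi(y-\delta u)}{2\delta}$; for $\delta=0$ they are exact. For every $0\le t\le T-1$, choose $$v^t\in\operatorname{argmax}\{\langle w,g^t\rangle: w\in C,\ w\le\bar u-x^t\}$$ (any choice that is a random variable determined by the information available at that time) and set $x^{t+1}=x^t+\frac1Tv^t$. **Theorem.** Suppose that $m\ge2T$, that $3(1+B)L_2D\,\delta\le\bar L$, and that either $m_0\bar L^2D^2\ge(1+B)^2G^2T^2$, or $\mathbb E_{z\sim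 p(\cdot;0)}\|\hat g(0;z)\|^2\le G^2$ and $m_0\bar L^2D^2\ge G^2T^2$. Let $x^*$ be a maximizer of $F$ over $C$. Then the output satisfies $x^T\in C$, $F(x^T)$ is integrable, and $$\mathbb E[F(x^T)]\ \ge\ e^{-1}F(x^*)-\frac{(2\sqrt2+0.5)\,\bar L D^2}{T}.$$ -/

import Mathlib

open MeasureTheory ProbabilityTheory Set
open scoped ENNReal

namespace SMCG

/-- The Euclidean space `ℝ^d`. -/
abbrev Vec (d : ℕ) := EuclideanSpace ℝ (Fin d)

/-- The box `[0, u] = {x : 0 ≤ x ≤ u}` (coordinatewise). -/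
def box {d : ℕ} (u : Vec d) : Set (Vec d) := {x | ∀ i, 0 ≤ x i ∧ x i ≤ u i}

/-- A set of nonnegative vectors is down-closed if `0 ≤ w ≤ v ∈ C` implies `w ∈ C`. -/
def DownClosed {d : ℕ} (C : Set (Vec d)) : Prop :=
  ∀ v ∈ C, ∀ w : Vec d, (∀ i, 0 ≤ w i ∧ w i ≤ v i) → w ∈ C

/-- DR-submodularity on `X`: the gain of adding `k ≥ 0` to a coordinate does not increase when
the base point increases coordinatewise. -/
def DRSubmodularOn {d : ℕ} (F : Vec d → ℝ) (X : Set (Vec d)) : Prop :=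
  ∀ x ∈ X, ∀ y ∈ X, (∀ i, x i ≤ y i) → ∀ (i : Fin d) (k : ℝ), 0 ≤ k →
    x + EuclideanSpace.single i k ∈ X → y + EuclideanSpace.single i k ∈ X →
      F (y + EuclideanSpace.single i k) - F y ≤ F (x + EuclideanSpace.single i k) - F x

section Model

variable {d : ℕ} {Z : Type*} [MeasurableSpace Z]

/-- The sampling distribution `p(· ; x)`, with density `p x` with respect to `μ`. -/
noncomputable def sampleLaw (μ : Measure Z) (p : Vec d → Z → ℝ) (x : Vec d) : Measure Z :=
  μ.withDensity fun z => ENNReal.ofReal (p x z)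

/-- The (non-oblivious) stochastic objective `F(x) = E_{z ∼ p(· ; x)} [Ft(x ; z)]`. -/
noncomputable def objective (μ : Measure Z) (p Ft : Vec d → Z → ℝ) (x : Vec d) : ℝ :=
  ∫ z, Ft x z ∂(sampleLaw μ p x)

/-- `∇ Ft(x ; z)`, the gradient in `x` for fixed `z`. -/
noncomputable def gradF (Ft : Vec d → Z → ℝ) (x : Vec d) (z : Z) : Vec d :=
  gradient (fun y => Ft y z) x

/-- `∇² Ft(x ; z)`, as a linear operator; its operator norm is the spectral norm. -/
noncomputable def hessF (Ft : Vec d → Z → ℝ) (x : Vec d) (z : Z) : Vec d →L[ℝ] Vec d :=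
  fderiv ℝ (fun y => gradF Ft y z) x

/-- `log p(z ; x)`. -/
noncomputable def logDensity (p : Vec d → Z → ℝ) (x : Vec d) (z : Z) : ℝ := Real.log (p x z)

/-- The unbiased gradient estimator `∇ Ft(x ; z) + Ft(x ; z) ∇ log p(z ; x)`. -/
noncomputable def gradEst (p Ft : Vec d → Z → ℝ) (x : Vec d) (z : Z) : Vec d :=
  gradF Ft x z + Ft x z • gradF (logDensity p) x z

/-- The product `∇² f(y ; z) u` (for `δ = 0`), or its approximation by the symmetric difference
quotient of gradients with parameter `δ` (for `δ ≠ 0`). -/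
noncomputable def hessVec (δ : ℝ) (f : Vec d → Z → ℝ) (y : Vec d) (z : Z) (u : Vec d) : Vec d :=
  if δ = 0 then hessF f y z u
  else (2 * δ)⁻¹ • (gradF f (y + δ • u) z - gradF f (y - δ • u) z)

/-- The Hessian estimator
`Ft (∇ log p)(∇ log p)ᵀ + (∇ log p)(∇ Ft)ᵀ + (∇ Ft)(∇ log p)ᵀ + ∇² Ft + Ft ∇² log p`
at `(y ; z)`, applied to the vector `u`; the two products of a Hessian with `u` are exact for
`δ = 0` and are replaced by difference quotients of gradients for `δ ≠ 0`. -/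
noncomputable def hessVecEst (δ : ℝ) (p Ft : Vec d → Z → ℝ) (y : Vec d) (z : Z) (u : Vec d) :
    Vec d :=
  (Ft y z * inner ℝ (gradF (logDensity p) y z) u) • gradF (logDensity p) y z
    + inner ℝ (gradF Ft y z) u • gradF (logDensity p) y z
    + inner ℝ (gradF (logDensity p) y z) u • gradF Ft y z
    + hessVec δ Ft y z u
    + Ft y z • hessVec δ (logDensity p) y z u

/-- The point `a y + (1 - a) x` of the segment from `x` to `y`. -/
def segPoint (x y : Vec d) (a : ℝ) : Vec d := a • y + (1 - a) • x

/-- The law of a pair `(a, z)`, where `a` is uniform on `[0, 1]` and, given `a`,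
`z ∼ p(· ; a y + (1 - a) x)`. -/
noncomputable def pairLaw (μ : Measure Z) (p : Vec d → Z → ℝ) (x y : Vec d) : Measure (ℝ × Z) :=
  (((volume : Measure ℝ).restrict (Icc 0 1)).prod μ).withDensity
    fun q => ENNReal.ofReal (p (segPoint x y q.1) q.2)

/-- A run of the algorithm SMCG++ with `T` steps, initial batch size `m₀`, batch size `m` and
difference parameter `δ`, on a probability space `(Ω, P)`.

`ℱ t` is the information available before the batch of iteration `t` is drawn, `z₀` is the
initial batch, `b t` the batch of pairs `(a, z)` drawn at iteration `t ≥ 1`, `g t` the gradient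
estimate, `v t` the ascent direction and `x t` the iterate. -/
structure IsRun {Ω : Type*} [MeasurableSpace Ω] (P : Measure Ω)
    (μ : Measure Z) (p Ft : Vec d → Z → ℝ) (C : Set (Vec d)) (ubar : Vec d)
    (T m₀ m : ℕ) (δ : ℝ) (ℱ : Filtration ℕ (inferInstance : MeasurableSpace Ω))
    (z₀ : Ω → Fin m₀ → Z) (b : ℕ → Ω → Fin m → ℝ × Z) (x g v : ℕ → Ω → Vec d) : Prop where
  measurable_z₀ : Measurable[ℱ 1] z₀
  measurable_b : ∀ t, t + 1 < T → Measurable[ℱ (t + 2)] (b (t + 1))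
  measurable_v : ∀ t < T, Measurable[ℱ (t + 1)] (v t)
  /-- The algorithm starts at the origin. -/
  x_zero : ∀ ω, x 0 ω = 0
  /-- The initial batch consists of `m₀` independent samples from `p(· ; 0)`. -/
  law_z₀ : P.map z₀ = Measure.pi fun _ : Fin m₀ => sampleLaw μ p 0
  g_zero : ∀ ω, g 0 ω = (m₀ : ℝ)⁻¹ • ∑ k, gradEst p Ft 0 (z₀ ω k)
  /-- Conditionally on the past, the batch of iteration `t + 1` consists of `m` independent
  pairs `(a, z)` with `a` uniform on `[0, 1]` and `z ∼ p(· ; a x^{t+1} + (1 - a) x^t)`. -/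
  law_b : ∀ t, t + 1 < T → ∀ A : Set Ω, MeasurableSet[ℱ (t + 1)] A →
    ∀ S : Set (Fin m → ℝ × Z), MeasurableSet S →
      P (A ∩ b (t + 1) ⁻¹' S)
        = ∫⁻ ω in A, (Measure.pi fun _ : Fin m => pairLaw μ p (x t ω) (x (t + 1) ω)) S ∂P
  g_succ : ∀ t, t + 1 < T → ∀ ω, g (t + 1) ω = g t ω + (m : ℝ)⁻¹ • ∑ k,
    hessVecEst δ p Ft (segPoint (x t ω) (x (t + 1) ω) (b (t + 1) ω k).1) (b (t + 1) ω k).2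
      (x (t + 1) ω - x t ω)
  /-- `v^t ∈ argmax {⟨w, g^t⟩ : w ∈ C, w ≤ ubar - x^t}`. -/
  v_mem : ∀ t < T, ∀ ω, v t ω ∈ C ∧ ∀ i, v t ω i ≤ ubar i - x t ω i
  v_max : ∀ t < T, ∀ ω, ∀ w ∈ C, (∀ i, w i ≤ ubar i - x t ω i) →
    inner ℝ w (g t ω) ≤ inner ℝ (v t ω) (g t ω)
  x_succ : ∀ t < T, ∀ ω, x (t + 1) ω = x t ω + (T : ℝ)⁻¹ • v t ω

end Model

/-- The constant `L̄ = (4 B² G⁴ + 16 G⁴ + 4 L² + 4 B² L²)^{1/2}`. -/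
noncomputable def Lbar (B G L : ℝ) : ℝ :=
  Real.sqrt (4 * B ^ 2 * G ^ 4 + 16 * G ^ 4 + 4 * L ^ 2 + 4 * B ^ 2 * L ^ 2)

end SMCG

/-! Write ∇F for `meanGrad`, the mean of the gradient estimator ĝ, and A = L̄D/T. By the score
identity ∇p = p ∇log p, the derivatives of p·Ft and p·ĝ along a segment in C are p times the
(directional) gradient and Hessian estimators. Integrating these derivatives over the segment and
using Fubini, instead of differentiating under the integral, shows that F(y) - F(x) is the integral
of ⟨∇F, y - x⟩ along the segment (`objective_sub_eq`) and that the exact Hessian estimator at a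
uniform point of the segment has mean ∇F(y) - ∇F(x) (`integral_stepEst_zero`). Its second moment is
at most L̄²‖y - x‖², so ∇F is L̄-Lipschitz on C and F has a quadratic first-order expansion there.

Gradient error: given the past, one step multiplies the mean square error by at most 1 + 1/(4T) and
adds at most 13A²/(9T), made of the variance of a batch of size m ≥ 2T and the bias of the
difference quotients (`lintegral_step_le`). The initial batch makes the error at most A², so it
stays below 4A² (`lintegral_error_le`), and the mean norm of the error below 2A.

Ascent: compare v with w = (x ⊔ x*) - x, which is admissible because 0 ≤ w ≤ x*. DR-submodularity is
concavity along nonnegative directions, so ⟨∇F(x), w⟩ ≥ F(x ⊔ x*) - F(x) (`objective_add_sub_le`).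
The constraint v ≤ ū - x gives x^t ≤ (1 - (1 - 1/T)^t) ū, and concavity with F ≥ 0 then yields F(x^t
⊔ x*) ≥ (1 - 1/T)^t F(x*) (`one_sub_mul_le_sup`). With `objective_step_ge`, E F(x^{t+1}) ≥ (1 - 1/T)
E F(x^t) + (1/T)(1 - 1/T)^t F(x*) - K/T², where K = (2√2 + 1/2) L̄D²: the term 2√2 comes from ‖v -
w‖ ≤ √2 D and the error 2A, the term 1/2 from the quadratic remainder. Unrolling gives (1 -
1/T)^{T-1} F(x*) - K/T, and (1 - 1/T)^{T-1} ≥ e⁻¹. -/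

namespace SMCG

/-! ### Second moments, averages of independent samples, conditional laws. -/

section

/-- The second moment of a vector-valued function is finite iff it is in `L²`. -/
lemma memLp_two_of_lintegral_le {S E : Type*} [MeasurableSpace S] [NormedAddCommGroup E]
    {ν : Measure S} {H : S → E} (hH : AEStronglyMeasurable H ν) {V : ℝ}
    (hV : ∫⁻ s, ‖H s‖ₑ ^ 2 ∂ν ≤ ENNReal.ofReal V) : MemLp H 2 ν := by
  refine ⟨hH, (eLpNorm_lt_top_iff_lintegral_rpow_enorm_lt_top (by norm_num) (by norm_num)).2 ?_⟩
  refine lt_of_le_of_lt ?_ (ENNReal.ofReal_lt_top (r := V))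
  simpa using hV

lemma lintegral_enorm_sq_eq_ofReal {S E : Type*} [MeasurableSpace S] [NormedAddCommGroup E]
    {ν : Measure S} {H : S → E} (hH : MemLp H 2 ν) :
    ∫⁻ s, ‖H s‖ₑ ^ 2 ∂ν = ENNReal.ofReal (∫ s, ‖H s‖ ^ 2 ∂ν) := by
  rw [ofReal_integral_eq_lintegral_ofReal ((memLp_two_iff_integrable_sq_norm hH.1).1 hH) (.of_forall fun s => by positivity)]
  refine lintegral_congr fun s => ?_
  rw [ENNReal.ofReal_pow (norm_nonneg _), ofReal_norm]

lemma integral_norm_sq_le_of_lintegral_le {S E : Type*} [MeasurableSpace S]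
    [NormedAddCommGroup E] {ν : Measure S} {H : S → E} (hH : AEStronglyMeasurable H ν) {V : ℝ}
    (hV0 : 0 ≤ V) (hV : ∫⁻ s, ‖H s‖ₑ ^ 2 ∂ν ≤ ENNReal.ofReal V) : ∫ s, ‖H s‖ ^ 2 ∂ν ≤ V := by
  rw [lintegral_enorm_sq_eq_ofReal (memLp_two_of_lintegral_le hH hV)] at hV
  exact (ENNReal.ofReal_le_ofReal_iff hV0).1 hV

/-- The square of the mean norm is at most the second moment. -/
lemma integral_norm_le_of_lintegral_sq_le {S E : Type*} [MeasurableSpace S]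
    [NormedAddCommGroup E] {ν : Measure S} [IsProbabilityMeasure ν] {H : S → E}
    (hH : AEStronglyMeasurable H ν) {c : ℝ}
    (hc : 0 ≤ c) (hV : ∫⁻ s, ‖H s‖ₑ ^ 2 ∂ν ≤ ENNReal.ofReal (c ^ 2)) : ∫ s, ‖H s‖ ∂ν ≤ c := by
  have hm := memLp_two_of_lintegral_le hH hV
  have h1 := integral_norm_sq_le_of_lintegral_le hH (sq_nonneg c) hV
  have h2 := variance_eq_sub hm.norm
  have h3 := variance_nonneg (fun s => ‖H s‖) ν
  rw [h2] at h3
  simp only [Pi.pow_apply] at h3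
  exact abs_le_of_sq_le_sq' (by linarith) hc |>.2

/-- The second moment of a translated average of `m` independent copies of `H`. -/
lemma lintegral_pi_average_le {d m : ℕ} (hm : 0 < m) {S : Type*} [MeasurableSpace S]
    (ν : Measure S) [IsProbabilityMeasure ν] {H : S → Vec d} (hH : Measurable H) {V : ℝ}
    (hV0 : 0 ≤ V) (hV : ∫⁻ s, ‖H s‖ₑ ^ 2 ∂ν ≤ ENNReal.ofReal V) (a : Vec d) :
    ∫⁻ s, ‖a + (m : ℝ)⁻¹ • ∑ k, H (s k)‖ₑ ^ 2 ∂(Measure.pi fun _ : Fin m => ν)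
      ≤ ENNReal.ofReal (‖a + ∫ s, H s ∂ν‖ ^ 2 + V / m) := by
  have hm' : (m : ℝ) ≠ 0 := by positivity
  have hL : MemLp H 2 ν := memLp_two_of_lintegral_le hH.aestronglyMeasurable hV
  have hLk : ∀ k : Fin m, MemLp (fun s : Fin m → S => H (s k)) 2 (Measure.pi fun _ => ν) :=
    fun k => hL.comp_measurePreserving (measurePreserving_eval (fun _ : Fin m => ν) k)
  have hX : MemLp (fun s : Fin m → S => a + (m : ℝ)⁻¹ • ∑ k, H (s k)) 2
      (Measure.pi fun _ => ν) :=
    (memLp_const a).add (MemLp.const_smul (f := fun s : Fin m → S => ∑ k, H (s k))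
      (memLp_finsetSum Finset.univ fun k _ => hLk k) ((m : ℝ)⁻¹))
  have hcoord : ∀ {S' : Type _} [MeasurableSpace S'] {ν' : Measure S'} {f : S' → Vec d},
      MemLp f 2 ν' → ∀ i, MemLp (fun s => f s i) 2 ν' := fun hf i =>
    hf.of_le (by
      exact (EuclideanSpace.proj (𝕜 := ℝ) i).continuous.comp_aestronglyMeasurable hf.1)
      (.of_forall fun s => PiLp.norm_apply_le _ i)
  rw [lintegral_enorm_sq_eq_ofReal hX]
  refine ENNReal.ofReal_le_ofReal ?_
  have hHi := hcoord hL
  have hV' := integral_norm_sq_le_of_lintegral_le hH.aestronglyMeasurable hV0 hV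
  -- Coordinatewise, the second moment is the squared mean plus the variance, and averaging m
  -- independent copies divides the variance by m.
  simp only [EuclideanSpace.norm_sq_eq, Real.norm_eq_abs, sq_abs] at hV' ⊢
  rw [integral_finsetSum _ fun i _ => (hHi i).integrable_sq] at hV'
  rw [integral_finsetSum _ fun i _ => (hcoord hX i).integrable_sq]
  have key : ∀ i, ∫ s : Fin m → S, ((a + (m : ℝ)⁻¹ • ∑ k, H (s k)) i) ^ 2
        ∂(Measure.pi fun _ : Fin m => ν)
      ≤ ((a + ∫ s, H s ∂ν) i) ^ 2 + (∫ s, (H s i) ^ 2 ∂ν) / m := by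
    intro i
    have hvar := variance_eq_sub (hcoord hX i)
    have hfun : (fun s : Fin m → S => (a + (m : ℝ)⁻¹ • ∑ k, H (s k)) i)
        = fun s => a i + (m : ℝ)⁻¹ * (∑ k, fun s : Fin m → S => H (s k) i) s := by
      ext s
      simp
    have hmean : ∫ s : Fin m → S, (a + (m : ℝ)⁻¹ • ∑ k, H (s k)) i
        ∂(Measure.pi fun _ : Fin m => ν) = (a + ∫ s, H s ∂ν) i := by
      have hk : ∀ k : Fin m, ∫ s : Fin m → S, H (s k) i ∂(Measure.pi fun _ : Fin m => ν)
          = ∫ s, H s i ∂ν := fun k =>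
        integral_comp_eval (μ := fun _ : Fin m => ν) (i := k) (f := fun s => H s i)
          (hHi i).aestronglyMeasurable
      have hint : ∫ s, H s i ∂ν = (∫ s, H s ∂ν) i :=
        (EuclideanSpace.proj (𝕜 := ℝ) i).integral_comp_comm (hL.integrable one_le_two)
      rw [hfun, integral_add (integrable_const _)]
      · rw [integral_const_mul]
        simp only [Finset.sum_apply]
        rw [integral_finsetSum _ fun k _ => (hcoord (hLk k) i).integrable one_le_two]
        simp only [hk, hint]
        simp [hm']
      · refine Integrable.const_mul ?_ _
        simp only [Finset.sum_fn]
        exact integrable_finsetSum _ fun k _ => (hcoord (hLk k) i).integrable one_le_two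
    have hv : Var[fun s : Fin m → S => (a + (m : ℝ)⁻¹ • ∑ k, H (s k)) i;
        Measure.pi fun _ : Fin m => ν] = Var[fun s => H s i; ν] / m := by
      have hsum : MemLp (∑ k : Fin m, fun s : Fin m → S => H (s k) i) 2
          (Measure.pi fun _ : Fin m => ν) :=
        memLp_finsetSum' _ fun k _ => hcoord (hLk k) i
      rw [hfun, variance_const_add (hsum.const_mul _).1, variance_const_mul,
        variance_sum_pi (μ := fun _ : Fin m => ν) (X := fun _ s => H s i) fun _ => hHi i]
      simp
      field_simp
    rw [hv, hmean] at hvar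
    have hvle := variance_le_expectation_sq (X := fun s => H s i) (μ := ν)
      (hHi i).aestronglyMeasurable
    have : Var[fun s => H s i; ν] / m ≤ (∫ s, (H s i) ^ 2 ∂ν) / m := by
      gcongr
      simpa using hvle
    simp only [Pi.pow_apply] at hvar
    linarith
  calc _ ≤ ∑ i, (((a + ∫ s, H s ∂ν) i) ^ 2 + (∫ s, (H s i) ^ 2 ∂ν) / m) :=
        Finset.sum_le_sum fun i _ => key i
    _ = ∑ i, ((a + ∫ s, H s ∂ν) i) ^ 2 + (∑ i, ∫ s, (H s i) ^ 2 ∂ν) / m := by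
        rw [Finset.sum_add_distrib, Finset.sum_div]
    _ ≤ _ := by gcongr

/-- Finite powers of a measurable family of probability measures form a measurable family. -/
lemma measurable_measure_pi {W S : Type*} [MeasurableSpace W] [MeasurableSpace S] {m : ℕ}
    {κ : W → Measure S} (hκ : Measurable κ) [∀ w, IsProbabilityMeasure (κ w)] :
    Measurable fun w => Measure.pi fun _ : Fin m => κ w := by
  refine Measurable.measure_of_isPiSystem_of_isProbabilityMeasure
    generateFrom_pi.symm isPiSystem_pi ?_
  rintro _ ⟨s, hs, rfl⟩
  simp only [Measure.pi_pi]
  exact Finset.measurable_prod _ fun k _ =>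
    Measure.measurable_measure.1 hκ _ (hs k (mem_univ k))

/-- Conditional expectation of a nonnegative function given the value of `Y`, when the
conditional law of `b` is a measurable function `κ` of `Y`. -/
lemma lintegral_comp_of_condLaw {Ω W S : Type*} [MeasurableSpace Ω] [MeasurableSpace W]
    [MeasurableSpace S] (P : Measure Ω) [IsProbabilityMeasure P] {Y : Ω → W} (hY : Measurable Y)
    {b : Ω → S} (hb : Measurable b) {κ : W → Measure S} (hκ : Measurable κ)
    [∀ w, IsProbabilityMeasure (κ w)]
    (h : ∀ A : Set W, MeasurableSet A → ∀ B : Set S, MeasurableSet B →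
      P (Y ⁻¹' A ∩ b ⁻¹' B) = ∫⁻ ω in Y ⁻¹' A, κ (Y ω) B ∂P)
    {f : W × S → ℝ≥0∞} (hf : Measurable f) :
    ∫⁻ ω, f (Y ω, b ω) ∂P = ∫⁻ ω, ∫⁻ s, f (Y ω, s) ∂κ (Y ω) ∂P := by
  let K : Kernel W S := ⟨κ, hκ⟩
  have : IsMarkovKernel K := ⟨fun w => inferInstanceAs (IsProbabilityMeasure (κ w))⟩
  have : IsProbabilityMeasure (P.map Y) := Measure.isProbabilityMeasure_map hY.aemeasurable
  have : IsProbabilityMeasure (P.map fun ω => (Y ω, b ω)) :=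
    Measure.isProbabilityMeasure_map (hY.prodMk hb).aemeasurable
  -- Rectangles determine a joint law, so the hypothesis identifies that of (Y, b) as the law of Y
  -- composed with the kernel.
  have hlaw : P.map (fun ω => (Y ω, b ω)) = P.map Y ⊗ₘ K := by
    refine Measure.ext_prod fun {A B} hA hB => ?_
    rw [Measure.map_apply (hY.prodMk hb) (hA.prod hB), Measure.compProd_apply_prod hA hB,
      setLIntegral_map hA (K.measurable_coe hB) hY]
    exact h A hA B hB
  rw [← lintegral_map hf (hY.prodMk hb), hlaw, Measure.lintegral_compProd hf,
    lintegral_map (hf.lintegral_kernel_prod_right' (κ := K)) hY]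
  rfl

/-- Differentiation under the integral sign in integrated form: no domination is needed, only
the integrability of the derivative on the product space. -/
lemma integral_sub_eq_integral_prod_deriv {Z E : Type*} [MeasurableSpace Z]
    [NormedAddCommGroup E] [NormedSpace ℝ E] [CompleteSpace E] {μ : Measure Z} [SFinite μ]
    {f f' : ℝ → Z → E} (hderiv : ∀ z, ∀ a ∈ Icc (0 : ℝ) 1, HasDerivAt (fun a => f a z) (f' a z) a)
    (hint : Integrable (fun q : ℝ × Z => f' q.1 q.2) ((volume.restrict (Icc 0 1)).prod μ))
    (h0 : Integrable (f 0) μ) (h1 : Integrable (f 1) μ) :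
    ∫ z, f 1 z ∂μ - ∫ z, f 0 z ∂μ
      = ∫ q : ℝ × Z, f' q.1 q.2 ∂((volume.restrict (Icc 0 1)).prod μ) := by
  rw [integral_prod_symm _ hint, ← integral_sub h1 h0]
  refine integral_congr_ae ?_
  -- Integrability on the product makes the derivative integrable in a for almost every z, which is
  -- all that the fundamental theorem of calculus needs.
  filter_upwards [hint.prod_left_ae] with z hz
  have hz' : IntervalIntegrable (fun a => f' a z) volume 0 1 := by
    rw [intervalIntegrable_iff_integrableOn_Icc_of_le zero_le_one]
    exact hz
  have := intervalIntegral.integral_eq_sub_of_hasDerivAt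
    (fun a ha => hderiv z a (by rwa [uIcc_of_le zero_le_one] at ha)) hz'
  rw [← this, intervalIntegral.integral_of_le zero_le_one, integral_Icc_eq_integral_Ioc]

end

/-! ### DR-submodular functions on a box. -/

section

/-- Diminishing returns along arbitrary nonnegative directions. -/
lemma DRSubmodularOn.add_sub_le {d : ℕ} {F : Vec d → ℝ} {u : Vec d}
    (hF : DRSubmodularOn F (box u)) {x y w : Vec d} (hx : x ∈ box u) (hxy : ∀ i, x i ≤ y i)
    (hw : ∀ i, 0 ≤ w i) (hyw : y + w ∈ box u) :
    F (y + w) - F y ≤ F (x + w) - F x := by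
  have hmem : ∀ v ∈ ({x, y} : Set (Vec d)), ∀ s : Finset (Fin d),
      v + ∑ i ∈ s, EuclideanSpace.single i (w i) ∈ box u := by
    intro v hv s i
    have h1 := hyw i
    have h2 := hx i
    have h3 := hxy i
    have h4 := hw i
    have h5 : (∑ i ∈ s, EuclideanSpace.single i (w i) : Vec d) i = if i ∈ s then w i else 0 := by
      simp [Finset.sum_apply, Pi.single_apply]
    simp only [PiLp.add_apply] at h1
    rw [PiLp.add_apply, h5]
    rcases hv with rfl | rfl <;> split_ifs <;> constructor <;> linarith
  -- The direction is added one coordinate at a time; `hmem` keeps the intermediate points in the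
  -- box.
  have key : ∀ s : Finset (Fin d),
      F (y + ∑ i ∈ s, EuclideanSpace.single i (w i)) - F y
        ≤ F (x + ∑ i ∈ s, EuclideanSpace.single i (w i)) - F x := by
    intro s
    induction s using Finset.induction_on with
    | empty => simp
    | insert j s hj ih =>
      have hm := fun v hv => hmem v hv (insert j s)
      simp only [Finset.sum_insert hj, add_comm (EuclideanSpace.single j (w j)),
        ← add_assoc] at hm ⊢
      have := hF _ (hmem x (by simp) s) _ (hmem y (by simp) s)
        (fun i => by simpa using hxy i) j (w j) (hw j) (hm x (by simp)) (hm y (by simp))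
      linarith
  have hsum : ∑ i, EuclideanSpace.single i (w i) = w := by
    ext i
    simp [Finset.sum_apply, Pi.single_apply]
  simpa only [hsum] using key Finset.univ

/-- Along a nonnegative direction the increments of a DR-submodular function are decreasing:
the values at equally spaced points form a concave sequence. -/
lemma DRSubmodularOn.nsmul_step {d : ℕ} {F : Vec d → ℝ} {u : Vec d}
    (hF : DRSubmodularOn F (box u)) {x w : Vec d} (hx : x ∈ box u) (hw : ∀ i, 0 ≤ w i)
    {n : ℕ} (hn : x + (n : ℝ) • w ∈ box u) {j k : ℕ} (hjk : j ≤ k) (hkn : k < n) :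
    F (x + ((k + 1 : ℕ) : ℝ) • w) - F (x + (k : ℝ) • w)
      ≤ F (x + ((j + 1 : ℕ) : ℝ) • w) - F (x + (j : ℝ) • w) := by
  have hmem : ∀ l : ℕ, l ≤ n → x + (l : ℝ) • w ∈ box u := by
    intro l hl i
    have h1 := hn i
    have h2 := hx i
    have h3 := hw i
    have h4 : (l : ℝ) * w i ≤ n * w i := by gcongr
    have h5 : 0 ≤ (l : ℝ) * w i := by positivity
    simp only [PiLp.add_apply, PiLp.smul_apply, smul_eq_mul] at h1 ⊢
    constructor <;> linarith
  have hs : ∀ l : ℕ, x + ((l + 1 : ℕ) : ℝ) • w = x + (l : ℝ) • w + w := by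
    intro l
    push_cast
    rw [add_smul, one_smul, add_assoc]
  rw [hs k, hs j]
  refine hF.add_sub_le (hmem j (by omega)) (fun i => ?_) hw (by rw [← hs]; exact hmem _ hkn)
  have h3 := hw i
  have : (j : ℝ) * w i ≤ k * w i := by gcongr
  simp only [PiLp.add_apply, PiLp.smul_apply, smul_eq_mul]
  linarith

/-- The chord inequality for sequences with decreasing increments. -/
lemma chord_le_of_step_le {φ : ℕ → ℝ} {n : ℕ}
    (h : ∀ j k, j ≤ k → k < n → φ (k + 1) - φ k ≤ φ (j + 1) - φ j) {k : ℕ} (hk : k ≤ n) :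
    (k : ℝ) * (φ n - φ 0) ≤ n * (φ k - φ 0) := by
  induction n, hk using Nat.le_induction with
  | base => rfl
  | succ n hkn ih =>
    have ih := ih fun j l hjl hl => h j l hjl (by omega)
    -- The newest increment is the smallest, so l copies of it are at most the sum of the first l
    -- increments.
    have hlow : ∀ l ≤ k, (l : ℝ) * (φ (n + 1) - φ n) ≤ φ l - φ 0 := by
      intro l hl
      induction l with
      | zero => simp
      | succ l ihl =>
        have := ihl (by omega)
        have := h l n (by omega) (by omega)
        push_cast
        linarith
    have := hlow k le_rfl
    push_cast
    nlinarith

/-- The first of n equal steps gains at least the average gain. As n → ∞ this becomes the gradient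
bound, and it needs a first-order expansion only near x. -/
lemma DRSubmodularOn.sub_le_nsmul {d : ℕ} {F : Vec d → ℝ} {u : Vec d}
    (hF : DRSubmodularOn F (box u)) {x w : Vec d} (hx : x ∈ box u) (hw : ∀ i, 0 ≤ w i)
    (hxw : x + w ∈ box u) {n : ℕ} (hn : 1 ≤ n) :
    F (x + w) - F x ≤ n * (F (x + (n : ℝ)⁻¹ • w) - F x) := by
  have hn' : (n : ℝ) ≠ 0 := by positivity
  have := chord_le_of_step_le (φ := fun k => F (x + (k : ℝ) • ((n : ℝ)⁻¹ • w))) (n := n)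
    (fun j k hjk hk => hF.nsmul_step hx
      (fun i => by simpa using mul_nonneg (by positivity) (hw i))
      (by rwa [smul_inv_smul₀ hn']) hjk hk) hn
  simpa [smul_inv_smul₀ hn'] using this

/-- A nonnegative DR-submodular function loses at most the fraction `θ` of its value when moving
the fraction `θ` of the way along a nonnegative segment in the box. -/
lemma DRSubmodularOn.one_sub_mul_le {d : ℕ} {F : Vec d → ℝ} {u : Vec d}
    (hF : DRSubmodularOn F (box u)) (hF0 : ∀ x ∈ box u, 0 ≤ F x) {x y : Vec d}
    (hx : x ∈ box u) (hy : ∀ i, 0 ≤ y i) (hxy : x + y ∈ box u) {θ : ℝ} (hθ0 : 0 ≤ θ)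
    (hθ1 : θ ≤ 1) : (1 - θ) * F x ≤ F (x + θ • y) := by
  rcases hθ0.eq_or_lt with rfl | hθ
  · simp
  -- Without continuity of F, the point x + θy must be a grid point: it is k steps of length θ/k.
  -- The last grid point on the segment is number n = ⌊k/θ⌋, where F ≥ 0; the rounding in n costs at
  -- most F(x)/k.
  have key : ∀ k : ℕ, 1 ≤ k → (1 - θ) * F x ≤ F (x + θ • y) + F x * (k : ℝ)⁻¹ := by
    intro k hk
    have hk' : (0 : ℝ) < k := by positivity
    set n := ⌊(k : ℝ) / θ⌋₊ with hn
    have hkn : k ≤ n := Nat.le_floor (by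
      rw [le_div_iff₀ hθ]
      nlinarith)
    have hn1 : (n : ℝ) ≤ k / θ := Nat.floor_le (by positivity)
    have hn2 : (k : ℝ) / θ < n + 1 := Nat.lt_floor_add_one _
    have hnθ : (n : ℝ) * (θ / k) ≤ 1 := by
      calc (n : ℝ) * (θ / k) ≤ k / θ * (θ / k) := by gcongr
        _ = 1 := by field_simp
    have hmem : x + (n : ℝ) • ((θ / k) • y) ∈ box u := by
      intro i
      have h1 := hx i
      have h2 := hxy i
      have h3 := hy i
      have h4 : (n : ℝ) * (θ / k) * y i ≤ 1 * y i := by gcongr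
      have h5 : 0 ≤ (n : ℝ) * (θ / k) * y i := by positivity
      simp only [PiLp.add_apply, PiLp.smul_apply, smul_eq_mul, ← mul_assoc] at h2 ⊢
      constructor <;> linarith
    have hchord := chord_le_of_step_le (φ := fun l => F (x + (l : ℝ) • ((θ / k) • y))) (n := n)
      (fun j l hjl hl => hF.nsmul_step hx
        (fun i => by simpa using mul_nonneg (by positivity) (hy i)) hmem hjl hl) hkn
    have hkθ : (k : ℝ) • ((θ / k) • y) = θ • y := by
      rw [smul_smul]
      congr 1
      field_simp
    simp only [hkθ, Nat.cast_zero, zero_smul, add_zero] at hchord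
    have hFn := hF0 _ hmem
    have hFx := hF0 _ hx
    have hn0 : (0 : ℝ) < n := lt_of_lt_of_le hk' (by exact_mod_cast hkn)
    have hn3 : (k : ℝ) < θ * (n + 1) := by
      rw [div_lt_iff₀ hθ] at hn2
      linarith
    have h1 : ((n : ℝ) - k) * F x ≤ n * F (x + θ • y) := by nlinarith
    have h2 : (n : ℝ) * (1 - θ) * F x ≤ n * F (x + θ • y) + θ * F x := by nlinarith
    have h3 : θ * F x ≤ n * (F x * (k : ℝ)⁻¹) := by
      have : θ ≤ n * (k : ℝ)⁻¹ := by
        rw [← div_eq_mul_inv, le_div_iff₀ hk']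
        have : (k : ℝ) ≤ n := by exact_mod_cast hkn
        nlinarith
      nlinarith
    nlinarith
  have hlim : Filter.Tendsto (fun k : ℕ => F (x + θ • y) + F x * (k : ℝ)⁻¹) Filter.atTop
      (nhds (F (x + θ • y) + F x * 0)) :=
    (tendsto_inv_atTop_nhds_zero_nat.const_mul _).const_add _
  rw [mul_zero, add_zero] at hlim
  exact ge_of_tendsto hlim (Filter.eventually_atTop.2 ⟨1, key⟩)

/-- The coordinatewise positive part of `y - x`, so that `x + posSub y x = x ⊔ y`. -/
noncomputable def posSub {d : ℕ} (y x : Vec d) : Vec d :=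
  WithLp.toLp 2 fun i => max (y i - x i) 0

lemma posSub_apply {d : ℕ} (y x : Vec d) (i : Fin d) : posSub y x i = max (y i - x i) 0 := rfl

/-- Both sides are x ⊔ y. The ascent starts at x, while the lower bound for the value at x ⊔ y
starts at y. -/
lemma add_posSub {d : ℕ} (y x : Vec d) : x + posSub y x = y + posSub x y := by
  ext i
  simp only [PiLp.add_apply, posSub_apply]
  rcases le_total (x i) (y i) with h | h
  · rw [max_eq_left (by linarith), max_eq_right (by linarith)]; ring
  · rw [max_eq_right (by linarith), max_eq_left (by linarith)]; ring

/-- If `x ≤ θ u`, then the value at `x ⊔ y` is at least `(1 - θ) F y`. -/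
lemma DRSubmodularOn.one_sub_mul_le_sup {d : ℕ} {F : Vec d → ℝ} {u : Vec d}
    (hF : DRSubmodularOn F (box u)) (hF0 : ∀ x ∈ box u, 0 ≤ F x) {x y : Vec d}
    (hx : x ∈ box u) (hy : y ∈ box u) {θ : ℝ} (hθ0 : 0 ≤ θ)
    (hθ1 : θ ≤ 1) (hxθ : ∀ i, x i ≤ θ * u i) : (1 - θ) * F y ≤ F (x + posSub y x) := by
  rw [add_posSub]
  rcases hθ0.eq_or_lt with rfl | hθ
  · have : posSub x y = 0 := by
      ext i
      have := hxθ i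
      have := hy i
      simp only [posSub_apply, PiLp.zero_apply, max_eq_right_iff]
      linarith
    simp [this]
  -- The direction (x - y)⁺ can be stretched by 1/θ without leaving the box, because x - y ≤ θu - y
  -- ≤ θ(u - y).
  · have h := hF.one_sub_mul_le hF0 (y := θ⁻¹ • posSub x y) hy (fun i => ?_) (fun i => ?_) hθ0 hθ1
    · rwa [smul_inv_smul₀ hθ.ne'] at h
    · simp only [PiLp.smul_apply, posSub_apply, smul_eq_mul]
      positivity
    · have h1 := hx i
      have h2 := hy i
      have h3 := hxθ i
      simp only [PiLp.add_apply, PiLp.smul_apply, posSub_apply, smul_eq_mul]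
      refine ⟨by have := h2.1; positivity, ?_⟩
      rcases le_total (x i) (y i) with h | h
      · rw [max_eq_right (by linarith)]
        linarith
      · rw [max_eq_left (by linarith)]
        have : θ⁻¹ * (x i - y i) ≤ u i - y i := by
          rw [inv_mul_le_iff₀ hθ]
          nlinarith
        linarith

end

/-! ### Measurability of derivatives that depend on a parameter. -/

section

/-- Directional derivatives of a function that depends measurably on a parameter are measurable. -/
lemma measurable_fderiv_apply_comp {V E Z W : Type*} [NormedAddCommGroup V] [NormedSpace ℝ V]
    [MeasurableSpace V] [BorelSpace V] [SecondCountableTopology V] [NormedAddCommGroup E]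
    [NormedSpace ℝ E] [MeasurableSpace E] [BorelSpace E] [SecondCountableTopology E]
    [MeasurableSpace Z] [MeasurableSpace W] {f : V → Z → E} {U : Set V}
    (hU : IsOpen U) (hf : Measurable fun q : U × Z => f q.1 q.2)
    (hdiff : ∀ z, ∀ x ∈ U, DifferentiableAt ℝ (fun y => f y z) x)
    {y u : W → V} {z : W → Z} (hy : Measurable y) (hu : Measurable u) (hz : Measurable z)
    (hyU : ∀ w, y w ∈ U) :
    Measurable fun w => fderiv ℝ (fun x => f x (z w)) (y w) (u w) := by
  let j : U × Z → V × Z := Prod.map Subtype.val id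
  have hj : MeasurableEmbedding j :=
    (MeasurableEmbedding.subtype_coe hU.measurableSet).prodMap MeasurableEmbedding.id
  -- The function is known to be measurable only over U. Its extension by zero is measurable
  -- everywhere, and since U is open the difference quotients at points of U eventually do not see
  -- the extension.
  let g : V × Z → E := Function.extend j (fun q : U × Z => f q.1 q.2) 0
  have hg : Measurable g := hj.measurable_extend hf measurable_zero
  have hgf : ∀ x ∈ U, ∀ z, g (x, z) = f x z := fun x hx z =>
    hj.injective.extend_apply (fun q : U × Z => f q.1 q.2) 0 (⟨x, hx⟩, z)
  refine measurable_of_tendsto_metrizable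
    (f := fun (n : ℕ) w => (n : ℝ) • (g (y w + (n : ℝ)⁻¹ • u w, z w) - g (y w, z w)))
    (fun n => by fun_prop) ?_
  rw [tendsto_pi_nhds]
  intro w
  have hlim := (hdiff (z w) (y w) (hyU w)).hasFDerivAt.lim (u w)
    (c := fun n : ℕ => (n : ℝ)) (l := Filter.atTop)
    (by simpa using tendsto_natCast_atTop_atTop (R := ℝ))
  refine hlim.congr' ?_
  have hto : Filter.Tendsto (fun n : ℕ => y w + (n : ℝ)⁻¹ • u w) Filter.atTop (nhds (y w)) := by
    simpa using ((tendsto_inv_atTop_nhds_zero_nat (𝕜 := ℝ)).smul_const (u w)).const_add (y w)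
  filter_upwards [hto.eventually (hU.mem_nhds (hyU w))] with n hn
  rw [hgf _ hn, hgf _ (hyU w)]

variable {d : ℕ} {Z W : Type*} [MeasurableSpace Z] [MeasurableSpace W]

/-- A family of `C²` functions on `U` that depends measurably on the parameter. -/
structure SmoothFamily (U : Set (Vec d)) (f : Vec d → Z → ℝ) : Prop where
  isOpen : IsOpen U
  measurable : Measurable (Function.uncurry f)
  contDiffOn : ∀ z, ContDiffOn ℝ 2 (fun x => f x z) U

namespace SmoothFamily

variable {U : Set (Vec d)} {f : Vec d → Z → ℝ}

lemma log (h : SmoothFamily U f) (hpos : ∀ x ∈ U, ∀ z, 0 < f x z) :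
    SmoothFamily U (logDensity f) where
  isOpen := h.isOpen
  measurable := h.measurable.log
  contDiffOn z := (h.contDiffOn z).log fun x hx => (hpos x hx z).ne'

lemma hasGradientAt (h : SmoothFamily U f) {x : Vec d} (hx : x ∈ U) (z : Z) :
    HasGradientAt (fun y => f y z) (gradF f x z) x :=
  (((h.contDiffOn z).contDiffAt (h.isOpen.mem_nhds hx)).differentiableAt two_ne_zero).hasGradientAt

lemma hasFDerivAt_gradF (h : SmoothFamily U f) {x : Vec d} (hx : x ∈ U) (z : Z) :
    HasFDerivAt (fun y => gradF f y z) (hessF f x z) x := by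
  have h1 : ContDiffAt ℝ 1 (fun y => fderiv ℝ (fun y => f y z) y) x :=
    ((h.contDiffOn z).contDiffAt (h.isOpen.mem_nhds hx)).fderiv_right (by norm_num)
  have h2 : DifferentiableAt ℝ (fun y => gradF f y z) x :=
    (InnerProductSpace.toDual ℝ (Vec d)).symm.toContinuousLinearEquiv.differentiableAt.comp x
      (h1.differentiableAt one_ne_zero)
  exact h2.hasFDerivAt

lemma measurable_comp (h : SmoothFamily U f) {y : W → Vec d} {z : W → Z} (hy : Measurable y)
    (hz : Measurable z) : Measurable fun w => f (y w) (z w) :=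
  h.measurable.comp (hy.prodMk hz)

lemma measurable_gradF_comp (h : SmoothFamily U f) {y : W → Vec d} {z : W → Z}
    (hy : Measurable y) (hz : Measurable z) (hyU : ∀ w, y w ∈ U) :
    Measurable fun w => gradF f (y w) (z w) := by
  have hcoord : ∀ w, gradF f (y w) (z w) = ∑ i, fderiv ℝ (fun x => f x (z w)) (y w)
      (EuclideanSpace.single i 1) • (EuclideanSpace.single i 1 : Vec d) := by
    intro w
    ext i
    rw [(h.hasGradientAt (hyU w) (z w)).hasFDerivAt.fderiv]
    simp [Finset.sum_apply, Pi.single_apply, EuclideanSpace.inner_single_right]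
  simp only [hcoord]
  refine Finset.measurable_sum _ fun i _ => Measurable.smul_const ?_ _
  exact measurable_fderiv_apply_comp h.isOpen
    (h.measurable_comp (measurable_subtype_coe.comp measurable_fst) measurable_snd)
    (fun z x hx => (h.hasGradientAt hx z).differentiableAt) hy measurable_const hz hyU

/-- The difference quotient argument once more, now for the gradient, whose measurability is
available only over U. -/
lemma measurable_hessF_comp (h : SmoothFamily U f) {y u : W → Vec d} {z : W → Z}
    (hy : Measurable y) (hu : Measurable u) (hz : Measurable z) (hyU : ∀ w, y w ∈ U) :
    Measurable fun w => hessF f (y w) (z w) (u w) :=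
  measurable_fderiv_apply_comp h.isOpen
    (h.measurable_gradF_comp (measurable_subtype_coe.comp measurable_fst) measurable_snd
      fun q => q.1.2)
    (fun z _ hx => (h.hasFDerivAt_gradF hx z).differentiableAt) hy hu hz hyU

lemma measurable_hessVec_comp (h : SmoothFamily U f) {δ : ℝ} {y u : W → Vec d} {z : W → Z}
    (hy : Measurable y) (hu : Measurable u) (hz : Measurable z) (hyU : ∀ w, y w ∈ U)
    (hadd : ∀ w, y w + δ • u w ∈ U) (hsub : ∀ w, y w - δ • u w ∈ U) :
    Measurable fun w => hessVec δ f (y w) (z w) (u w) := by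
  unfold hessVec
  split_ifs
  · exact h.measurable_hessF_comp hy hu hz hyU
  · exact ((h.measurable_gradF_comp (by fun_prop) hz hadd).sub
      (h.measurable_gradF_comp (by fun_prop) hz hsub)).const_smul ((2 * δ)⁻¹)

end SmoothFamily

lemma measurable_gradEst_comp {U : Set (Vec d)} {p Ft : Vec d → Z → ℝ}
    (hFt : SmoothFamily U Ft) (hlog : SmoothFamily U (logDensity p))
    {y : W → Vec d} {z : W → Z} (hy : Measurable y) (hz : Measurable z) (hyU : ∀ w, y w ∈ U) :
    Measurable fun w => gradEst p Ft (y w) (z w) :=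
  (hFt.measurable_gradF_comp hy hz hyU).add
    ((hFt.measurable_comp hy hz).smul (hlog.measurable_gradF_comp hy hz hyU))

lemma measurable_hessVecEst_comp {U : Set (Vec d)} {p Ft : Vec d → Z → ℝ}
    (hFt : SmoothFamily U Ft) (hlog : SmoothFamily U (logDensity p)) {δ : ℝ}
    {y u : W → Vec d} {z : W → Z} (hy : Measurable y) (hu : Measurable u) (hz : Measurable z)
    (hyU : ∀ w, y w ∈ U) (hadd : ∀ w, y w + δ • u w ∈ U) (hsub : ∀ w, y w - δ • u w ∈ U) :
    Measurable fun w => hessVecEst δ p Ft (y w) (z w) (u w) := by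
  have h1 := hFt.measurable_comp hy hz
  have h2 := hFt.measurable_gradF_comp hy hz hyU
  have h3 := hlog.measurable_gradF_comp hy hz hyU
  have h4 := hFt.measurable_hessVec_comp hy hu hz hyU hadd hsub
  have h5 := hlog.measurable_hessVec_comp hy hu hz hyU hadd hsub
  unfold hessVecEst
  refine Measurable.add (Measurable.add (Measurable.add (Measurable.add ?_ ?_) ?_) h4) ?_
  · exact (h1.mul (h3.inner (𝕜 := ℝ) hu)).smul h3
  · exact (h2.inner (𝕜 := ℝ) hu).smul h3
  · exact (h3.inner (𝕜 := ℝ) hu).smul h2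
  · exact h1.smul h5

end

/-! ### Regular models and second moments of the estimators. -/

section

variable {d : ℕ} {Z W : Type*} [MeasurableSpace Z] [MeasurableSpace W]

/-- The regularity assumptions on the model. -/
structure Regular (μ : Measure Z) (p Ft : Vec d → Z → ℝ) (C U : Set (Vec d))
    (D δ B G L L₂ : ℝ) : Prop where
  smooth_Ft : SmoothFamily U Ft
  smooth_p : SmoothFamily U p
  pos : ∀ x ∈ U, ∀ z, 0 < p x z
  convex : Convex ℝ C
  norm_le : ∀ x ∈ C, ‖x‖ ≤ D
  δ_nonneg : 0 ≤ δ
  D_nonneg : 0 ≤ D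
  B_nonneg : 0 ≤ B
  G_nonneg : 0 ≤ G
  L_nonneg : 0 ≤ L
  L₂_nonneg : 0 ≤ L₂
  ball : ∀ c ∈ C, Metric.closedBall c (δ * D) ⊆ U
  prob : ∀ x ∈ C, IsProbabilityMeasure (sampleLaw μ p x)
  Ft_le : ∀ x ∈ C, ∀ z, |Ft x z| ≤ B
  grad_Ft_le : ∀ x ∈ C, ∀ z, ‖gradF Ft x z‖ ≤ G
  grad_p_le : ∀ x ∈ C, ∫⁻ z, ‖gradF (logDensity p) x z‖ₑ ^ 4 ∂(sampleLaw μ p x)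
    ≤ ENNReal.ofReal (G ^ 4)
  hess_Ft_le : ∀ x ∈ C, ∀ z, ‖hessF Ft x z‖ ≤ L
  hess_p_le : ∀ x ∈ C, ∫⁻ z, ‖hessF (logDensity p) x z‖ₑ ^ 2 ∂(sampleLaw μ p x)
    ≤ ENNReal.ofReal (L ^ 2)
  lip_Ft : ∀ c ∈ C, ∀ x ∈ Metric.closedBall c (δ * D), ∀ z,
    ‖hessF Ft x z - hessF Ft c z‖ ≤ L₂ * ‖x - c‖
  lip_p : ∀ c ∈ C, ∀ x ∈ Metric.closedBall c (δ * D), ∀ z,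
    ‖hessF (logDensity p) x z - hessF (logDensity p) c z‖ ≤ L₂ * ‖x - c‖

/-- The segment from `x` to `y`, extended by constants outside `[0, 1]`. -/
noncomputable def clampSeg (x y : Vec d) (a : ℝ) : Vec d :=
  segPoint x y (projIcc 0 1 zero_le_one a : Icc (0 : ℝ) 1)

lemma clampSeg_of_mem (x y : Vec d) {a : ℝ} (ha : a ∈ Icc (0 : ℝ) 1) :
    clampSeg x y a = segPoint x y a := by
  rw [clampSeg, projIcc_of_mem zero_le_one ha]

@[fun_prop]
lemma measurable_clampSeg_comp {x y : W → Vec d} {a : W → ℝ} (hx : Measurable x)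
    (hy : Measurable y) (ha : Measurable a) : Measurable fun w => clampSeg (x w) (y w) (a w) := by
  have : Measurable fun w => ((projIcc 0 1 zero_le_one (a w) : Icc (0 : ℝ) 1) : ℝ) :=
    measurable_subtype_coe.comp (continuous_projIcc.measurable.comp ha)
  unfold clampSeg segPoint
  fun_prop

lemma segPoint_sub (x y : Vec d) (a : ℝ) : segPoint x y a - x = a • (y - x) := by
  rw [segPoint]
  module

lemma clampSeg_mem {C : Set (Vec d)} (hC : Convex ℝ C) {x y : Vec d} (hx : x ∈ C) (hy : y ∈ C)
    (a : ℝ) : clampSeg x y a ∈ C := by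
  obtain ⟨h0, h1⟩ := (projIcc 0 1 zero_le_one a : Icc (0 : ℝ) 1).2
  exact hC hy hx h0 (by linarith) (by ring)

lemma hasDerivAt_segPoint (x y : Vec d) (a : ℝ) :
    HasDerivAt (fun a => segPoint x y a) (y - x) a := by
  have h := ((hasDerivAt_id a).smul_const y).add (((hasDerivAt_id a).const_sub 1).smul_const x)
  convert! h using 1
  module

/-- The base measure of the pairs. -/
noncomputable abbrev pairBase (μ : Measure Z) : Measure (ℝ × Z) :=
  ((volume : Measure ℝ).restrict (Icc 0 1)).prod μ

lemma ae_pairBase_mem (μ : Measure Z) [SFinite μ] : ∀ᵐ q ∂(pairBase μ), q.1 ∈ Icc (0 : ℝ) 1 :=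
  Measure.quasiMeasurePreserving_fst.ae (ae_restrict_mem measurableSet_Icc)

/-- The parameter a lies in [0, 1] almost surely, so clamping leaves the law unchanged. It puts
every evaluation point into C, where the bounds hold and the derivatives are measurable. -/
lemma pairLaw_eq_clamp (μ : Measure Z) [SFinite μ] (p : Vec d → Z → ℝ) (x y : Vec d) :
    pairLaw μ p x y
      = (pairBase μ).withDensity fun q => ENNReal.ofReal (p (clampSeg x y q.1) q.2) := by
  refine withDensity_congr_ae ?_
  filter_upwards [ae_pairBase_mem μ] with q hq
  rw [clampSeg_of_mem x y hq]

lemma ae_pairLaw_mem (μ : Measure Z) [SFinite μ] (p : Vec d → Z → ℝ) (x y : Vec d) :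
    ∀ᵐ q ∂(pairLaw μ p x y), q.1 ∈ Icc (0 : ℝ) 1 :=
  (withDensity_absolutelyContinuous _ _).ae_le (ae_pairBase_mem μ)

/-- The mean of the gradient estimator. -/
noncomputable def meanGrad (μ : Measure Z) (p Ft : Vec d → Z → ℝ) (x : Vec d) : Vec d :=
  ∫ z, gradEst p Ft x z ∂(sampleLaw μ p x)

/-- The estimator of the gradient difference along the segment from `x` to `y`. -/
noncomputable def stepEst (δ : ℝ) (p Ft : Vec d → Z → ℝ) (x y : Vec d) (q : ℝ × Z) : Vec d :=
  hessVecEst δ p Ft (clampSeg x y q.1) q.2 (y - x)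

namespace SmoothFamily

variable {U : Set (Vec d)} {f : Vec d → Z → ℝ}

lemma hasDerivAt_segPoint (h : SmoothFamily U f) {x y : Vec d} {a : ℝ}
    (ha : segPoint x y a ∈ U) (z : Z) :
    HasDerivAt (fun a => f (segPoint x y a) z)
      (inner ℝ (gradF f (segPoint x y a) z) (y - x)) a := by
  have := (h.hasGradientAt ha z).hasFDerivAt.comp_hasDerivAt a (SMCG.hasDerivAt_segPoint x y a)
  rwa [InnerProductSpace.toDual_apply_apply] at this

lemma hasDerivAt_gradF_segPoint (h : SmoothFamily U f) {x y : Vec d} {a : ℝ}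
    (ha : segPoint x y a ∈ U) (z : Z) :
    HasDerivAt (fun a => gradF f (segPoint x y a) z) (hessF f (segPoint x y a) z (y - x)) a :=
  (h.hasFDerivAt_gradF ha z).comp_hasDerivAt a (SMCG.hasDerivAt_segPoint x y a)

/-- The score identity, from the chain rule for log: derivatives of the density become expectations
under the sampling law. -/
lemma gradF_eq_smul_gradF_log (h : SmoothFamily U f) (hpos : ∀ x ∈ U, ∀ z, 0 < f x z)
    {x : Vec d} (hx : x ∈ U) (z : Z) : gradF f x z = f x z • gradF (logDensity f) x z := by
  have h1 := (h.hasGradientAt hx z).hasFDerivAt.log (hpos x hx z).ne'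
  have h2 := ((h.log hpos).hasGradientAt hx z).hasFDerivAt.unique h1
  apply (InnerProductSpace.toDual ℝ (Vec d)).injective
  rw [map_smul, h2, smul_inv_smul₀ (hpos x hx z).ne']

end SmoothFamily

namespace Regular

variable {μ : Measure Z} {p Ft : Vec d → Z → ℝ} {C U : Set (Vec d)} {D δ B G L L₂ : ℝ}

lemma smooth_log (h : Regular μ p Ft C U D δ B G L L₂) : SmoothFamily U (logDensity p) :=
  h.smooth_p.log h.pos

lemma subset (h : Regular μ p Ft C U D δ B G L L₂) : C ⊆ U := fun c hc =>
  h.ball c hc (Metric.mem_closedBall_self (mul_nonneg h.δ_nonneg h.D_nonneg))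

lemma measurable_density (h : Regular μ p Ft C U D δ B G L L₂) {y : W → Vec d} {z : W → Z}
    (hy : Measurable y) (hz : Measurable z) : Measurable fun w => ENNReal.ofReal (p (y w) (z w)) :=
  (h.smooth_p.measurable_comp hy hz).ennreal_ofReal

lemma measurable_density_apply (h : Regular μ p Ft C U D δ B G L L₂) (x : Vec d) :
    Measurable fun z => ENNReal.ofReal (p x z) :=
  h.measurable_density measurable_const measurable_id

lemma integral_sampleLaw (h : Regular μ p Ft C U D δ B G L L₂) {E : Type*}
    [NormedAddCommGroup E] [NormedSpace ℝ E] {x : Vec d} (hx : x ∈ C) (f : Z → E) :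
    ∫ z, f z ∂(sampleLaw μ p x) = ∫ z, p x z • f z ∂μ := by
  rw [sampleLaw, integral_withDensity_eq_integral_toReal_smul
    (h.measurable_density_apply x) (.of_forall fun _ => ENNReal.ofReal_lt_top)]
  refine integral_congr_ae (.of_forall fun z => ?_)
  simp only [ENNReal.toReal_ofReal (h.pos x (h.subset hx) z).le]

lemma integrable_sampleLaw_iff (h : Regular μ p Ft C U D δ B G L L₂) {E : Type*}
    [NormedAddCommGroup E] [NormedSpace ℝ E] {x : Vec d} (hx : x ∈ C) (f : Z → E) :
    Integrable f (sampleLaw μ p x) ↔ Integrable (fun z => p x z • f z) μ := by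
  rw [sampleLaw, integrable_withDensity_iff_integrable_smul'
    (h.measurable_density_apply x) (.of_forall fun _ => ENNReal.ofReal_lt_top)]
  refine integrable_congr (.of_forall fun z => ?_)
  simp only [ENNReal.toReal_ofReal (h.pos x (h.subset hx) z).le]

lemma integral_pairLaw [SFinite μ] (h : Regular μ p Ft C U D δ B G L L₂) {E : Type*}
    [NormedAddCommGroup E] [NormedSpace ℝ E] {x y : Vec d} (hx : x ∈ C) (hy : y ∈ C)
    (f : ℝ × Z → E) :
    ∫ q, f q ∂(pairLaw μ p x y) = ∫ q, p (clampSeg x y q.1) q.2 • f q ∂(pairBase μ) := by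
  rw [pairLaw_eq_clamp, integral_withDensity_eq_integral_toReal_smul
    (h.measurable_density (by fun_prop) measurable_snd) (.of_forall fun _ => ENNReal.ofReal_lt_top)]
  refine integral_congr_ae (.of_forall fun q => ?_)
  simp only [ENNReal.toReal_ofReal (h.pos _ (h.subset (clampSeg_mem h.convex hx hy q.1)) q.2).le]

lemma integrable_pairLaw_iff [SFinite μ] (h : Regular μ p Ft C U D δ B G L L₂) {E : Type*}
    [NormedAddCommGroup E] [NormedSpace ℝ E] {x y : Vec d} (hx : x ∈ C) (hy : y ∈ C)
    (f : ℝ × Z → E) :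
    Integrable f (pairLaw μ p x y)
      ↔ Integrable (fun q => p (clampSeg x y q.1) q.2 • f q) (pairBase μ) := by
  rw [pairLaw_eq_clamp, integrable_withDensity_iff_integrable_smul'
    (h.measurable_density (by fun_prop) measurable_snd) (.of_forall fun _ => ENNReal.ofReal_lt_top)]
  refine integrable_congr (.of_forall fun q => ?_)
  simp only [ENNReal.toReal_ofReal (h.pos _ (h.subset (clampSeg_mem h.convex hx hy q.1)) q.2).le]

lemma lintegral_pairLaw [SFinite μ] (h : Regular μ p Ft C U D δ B G L L₂) (x y : Vec d)
    {f : ℝ × Z → ℝ≥0∞} (hf : Measurable f) :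
    ∫⁻ q, f q ∂(pairLaw μ p x y)
      = ∫⁻ a in Icc (0 : ℝ) 1, ∫⁻ z, f (a, z) ∂(sampleLaw μ p (clampSeg x y a)) := by
  have hm : Measurable fun q : ℝ × Z => ENNReal.ofReal (p (clampSeg x y q.1) q.2) :=
    h.measurable_density (by fun_prop) measurable_snd
  rw [pairLaw_eq_clamp, lintegral_withDensity_eq_lintegral_mul _ hm hf,
    lintegral_prod _ (hm.mul hf).aemeasurable]
  refine lintegral_congr fun a => ?_
  rw [sampleLaw, lintegral_withDensity_eq_lintegral_mul _
    (h.measurable_density_apply _)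
      (show Measurable fun z => f (a, z) from hf.comp measurable_prodMk_left)]
  rfl

lemma lintegral_pairLaw_le [SFinite μ] (h : Regular μ p Ft C U D δ B G L L₂) (x y : Vec d)
    {f : ℝ × Z → ℝ≥0∞} (hf : Measurable f) {c : ℝ≥0∞}
    (hc : ∀ a, ∫⁻ z, f (a, z) ∂(sampleLaw μ p (clampSeg x y a)) ≤ c) :
    ∫⁻ q, f q ∂(pairLaw μ p x y) ≤ c := by
  rw [h.lintegral_pairLaw x y hf]
  refine (lintegral_mono hc).trans ?_
  simp

lemma isProbabilityMeasure_pairLaw [SFinite μ] (h : Regular μ p Ft C U D δ B G L L₂)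
    {x y : Vec d} (hx : x ∈ C) (hy : y ∈ C) : IsProbabilityMeasure (pairLaw μ p x y) := by
  constructor
  rw [← lintegral_one, h.lintegral_pairLaw x y measurable_const]
  have : ∀ a, ∫⁻ _, 1 ∂(sampleLaw μ p (clampSeg x y a)) = 1 := fun a => by
    have := h.prob _ (clampSeg_mem h.convex hx hy a)
    simp
  simp [this]

lemma add_smul_mem (h : Regular μ p Ft C U D δ B G L L₂) {c u : Vec d}
    (hu : ‖u‖ ≤ D) : c + δ • u ∈ Metric.closedBall c (δ * D) := by
  rw [mem_closedBall_iff_norm, add_sub_cancel_left, norm_smul, Real.norm_of_nonneg h.δ_nonneg]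
  exact mul_le_mul_of_nonneg_left hu h.δ_nonneg

lemma sub_smul_mem (h : Regular μ p Ft C U D δ B G L L₂) {c u : Vec d}
    (hu : ‖u‖ ≤ D) : c - δ • u ∈ Metric.closedBall c (δ * D) := by
  simpa [sub_eq_add_neg] using h.add_smul_mem (c := c) (u := -u) (by simpa using hu)

lemma measurable_gradEst (h : Regular μ p Ft C U D δ B G L L₂) {y : W → Vec d} {z : W → Z}
    (hy : Measurable y) (hz : Measurable z) (hyC : ∀ w, y w ∈ C) :
    Measurable fun w => gradEst p Ft (y w) (z w) :=
  measurable_gradEst_comp h.smooth_Ft h.smooth_log hy hz fun w => h.subset (hyC w)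

lemma measurable_stepEst_zero (h : Regular μ p Ft C U D δ B G L L₂) {x y : W → Vec d}
    {q : W → ℝ × Z} (hx : Measurable x) (hy : Measurable y) (hq : Measurable q)
    (hxC : ∀ w, x w ∈ C) (hyC : ∀ w, y w ∈ C) :
    Measurable fun w => stepEst 0 p Ft (x w) (y w) (q w) := by
  have hU : ∀ w, clampSeg (x w) (y w) (q w).1 ∈ U := fun w =>
    h.subset (clampSeg_mem h.convex (hxC w) (hyC w) _)
  exact measurable_hessVecEst_comp h.smooth_Ft h.smooth_log (by fun_prop) (hy.sub hx) (by fun_prop)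
    hU (by simpa using hU) (by simpa using hU)

lemma measurable_stepEst (h : Regular μ p Ft C U D δ B G L L₂) {x y : W → Vec d}
    {q : W → ℝ × Z} (hx : Measurable x) (hy : Measurable y) (hq : Measurable q)
    (hxC : ∀ w, x w ∈ C) (hyC : ∀ w, y w ∈ C) (hD : ∀ w, ‖y w - x w‖ ≤ D) :
    Measurable fun w => stepEst δ p Ft (x w) (y w) (q w) := by
  have hC : ∀ w, clampSeg (x w) (y w) (q w).1 ∈ C := fun w =>
    clampSeg_mem h.convex (hxC w) (hyC w) _
  exact measurable_hessVecEst_comp h.smooth_Ft h.smooth_log (by fun_prop) (hy.sub hx) (by fun_prop)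
    (fun w => h.subset (hC w)) (fun w => h.ball _ (hC w) (h.add_smul_mem (hD w)))
    (fun w => h.ball _ (hC w) (h.sub_smul_mem (hD w)))

lemma Lbar_nonneg (B G L : ℝ) : 0 ≤ Lbar B G L := Real.sqrt_nonneg _

lemma Lbar_sq (B G L : ℝ) :
    Lbar B G L ^ 2 = 4 * B ^ 2 * G ^ 4 + 16 * G ^ 4 + 4 * L ^ 2 + 4 * B ^ 2 * L ^ 2 :=
  Real.sq_sqrt (by positivity)

/-- The pointwise bound behind the second moment of the Hessian estimator. -/
lemma norm_hessVecEst_zero_sq_le (h : Regular μ p Ft C U D δ B G L L₂) {x : Vec d} (hx : x ∈ C)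
    (z : Z) (u : Vec d) :
    ‖hessVecEst 0 p Ft x z u‖ ^ 2 ≤ ‖u‖ ^ 2 * ((4 * B ^ 2 + 8) * ‖gradF (logDensity p) x z‖ ^ 4
      + (8 * G ^ 4 + 4 * L ^ 2) + 4 * B ^ 2 * ‖hessF (logDensity p) x z‖ ^ 2) := by
  have hFt := h.Ft_le x hx z
  have hgF := h.grad_Ft_le x hx z
  have hhF := h.hess_Ft_le x hx z
  have hB := h.B_nonneg
  have hG := h.G_nonneg
  have hL := h.L_nonneg
  simp only [hessVecEst, hessVec, if_true]
  set g := gradF (logDensity p) x z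
  set f := gradF Ft x z
  set r := Ft x z
  set Hl := hessF (logDensity p) x z
  set Hf := hessF Ft x z
  have i1 : |inner ℝ g u| ≤ ‖g‖ * ‖u‖ := abs_real_inner_le_norm g u
  have i2 : |inner ℝ f u| ≤ G * ‖u‖ := (abs_real_inner_le_norm f u).trans (by gcongr)
  have t1 : ‖(r * inner ℝ g u) • g‖ ≤ ‖u‖ * (B * ‖g‖ ^ 2) := by
    rw [norm_smul, Real.norm_eq_abs, abs_mul]
    calc |r| * |inner ℝ g u| * ‖g‖ ≤ B * (‖g‖ * ‖u‖) * ‖g‖ := by gcongr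
      _ = _ := by ring
  have t2 : ‖inner ℝ f u • g‖ ≤ ‖u‖ * (G * ‖g‖) := by
    rw [norm_smul, Real.norm_eq_abs]
    calc |inner ℝ f u| * ‖g‖ ≤ G * ‖u‖ * ‖g‖ := by gcongr
      _ = _ := by ring
  have t3 : ‖inner ℝ g u • f‖ ≤ ‖u‖ * (G * ‖g‖) := by
    rw [norm_smul, Real.norm_eq_abs]
    calc |inner ℝ g u| * ‖f‖ ≤ ‖g‖ * ‖u‖ * G := by gcongr
      _ = _ := by ring
  have t4 : ‖Hf u‖ ≤ ‖u‖ * L := by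
    refine (Hf.le_opNorm u).trans ?_
    rw [mul_comm]
    gcongr
  have t5 : ‖r • Hl u‖ ≤ ‖u‖ * (B * ‖Hl‖) := by
    rw [norm_smul, Real.norm_eq_abs]
    calc |r| * ‖Hl u‖ ≤ B * (‖Hl‖ * ‖u‖) := by
          gcongr
          exact Hl.le_opNorm u
      _ = _ := by ring
  have hsum : ‖(r * inner ℝ g u) • g + inner ℝ f u • g + inner ℝ g u • f + Hf u + r • Hl u‖
      ≤ ‖u‖ * (B * ‖g‖ ^ 2 + 2 * (G * ‖g‖) + L + B * ‖Hl‖) := by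
    have n1 := norm_add_le ((r * inner ℝ g u) • g + inner ℝ f u • g + inner ℝ g u • f + Hf u)
      (r • Hl u)
    have n2 := norm_add_le ((r * inner ℝ g u) • g + inner ℝ f u • g + inner ℝ g u • f) (Hf u)
    have n3 := norm_add_le ((r * inner ℝ g u) • g + inner ℝ f u • g) (inner ℝ g u • f)
    have n4 := norm_add_le ((r * inner ℝ g u) • g) (inner ℝ f u • g)
    linarith
  have four : ∀ a b c e : ℝ,
      (a + b + c + e) ^ 2 ≤ 4 * a ^ 2 + 4 * b ^ 2 + 4 * c ^ 2 + 4 * e ^ 2 := fun a b c e => by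
    nlinarith [sq_nonneg (a - b), sq_nonneg (a - c), sq_nonneg (a - e), sq_nonneg (b - c),
      sq_nonneg (b - e), sq_nonneg (c - e)]
  have hinner : (B * ‖g‖ ^ 2 + 2 * (G * ‖g‖) + L + B * ‖Hl‖) ^ 2 ≤ (4 * B ^ 2 + 8) * ‖g‖ ^ 4
      + (8 * G ^ 4 + 4 * L ^ 2) + 4 * B ^ 2 * ‖Hl‖ ^ 2 := by
    have := four (B * ‖g‖ ^ 2) (2 * (G * ‖g‖)) L (B * ‖Hl‖)
    -- The term 16G²‖g‖² is split into 8G⁴ + 8‖g‖⁴, so that only the fourth moment of the score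
    -- enters.
    nlinarith [sq_nonneg (G ^ 2 - ‖g‖ ^ 2)]
  calc _ ≤ (‖u‖ * (B * ‖g‖ ^ 2 + 2 * (G * ‖g‖) + L + B * ‖Hl‖)) ^ 2 := by gcongr
    _ = ‖u‖ ^ 2 * (B * ‖g‖ ^ 2 + 2 * (G * ‖g‖) + L + B * ‖Hl‖) ^ 2 := by ring
    _ ≤ _ := by gcongr

/-- Integrating the pointwise bound gives (4B² + 8)G⁴ + 8G⁴ + 4L² + 4B²L², which is exactly L̄². -/
lemma lintegral_hessVecEst_zero_le (h : Regular μ p Ft C U D δ B G L L₂) {x : Vec d} (hx : x ∈ C)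
    (u : Vec d) :
    ∫⁻ z, ‖hessVecEst 0 p Ft x z u‖ₑ ^ 2 ∂(sampleLaw μ p x)
      ≤ ENNReal.ofReal ((Lbar B G L * ‖u‖) ^ 2) := by
  have hprob := h.prob x hx
  have hmeas : Measurable fun z => gradF (logDensity p) x z :=
    h.smooth_log.measurable_gradF_comp measurable_const measurable_id fun _ => h.subset hx
  have hpt : ∀ z, ‖hessVecEst 0 p Ft x z u‖ₑ ^ 2 ≤ ENNReal.ofReal (‖u‖ ^ 2)
      * (ENNReal.ofReal (4 * B ^ 2 + 8) * ‖gradF (logDensity p) x z‖ₑ ^ 4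
        + ENNReal.ofReal (8 * G ^ 4 + 4 * L ^ 2)
        + ENNReal.ofReal (4 * B ^ 2) * ‖hessF (logDensity p) x z‖ₑ ^ 2) := by
    intro z
    rw [← ofReal_norm, ← ofReal_norm, ← ofReal_norm, ← ENNReal.ofReal_pow (norm_nonneg _),
      ← ENNReal.ofReal_pow (norm_nonneg _), ← ENNReal.ofReal_pow (norm_nonneg _),
      ← ENNReal.ofReal_mul (by positivity), ← ENNReal.ofReal_mul (by positivity),
      ← ENNReal.ofReal_add (by positivity) (by positivity),
      ← ENNReal.ofReal_add (by positivity) (by positivity), ← ENNReal.ofReal_mul (by positivity)]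
    exact ENNReal.ofReal_le_ofReal (h.norm_hessVecEst_zero_sq_le hx z u)
  refine (lintegral_mono hpt).trans ?_
  -- The Hessian norm is the right summand, and finite constants come out of any lower integral, so
  -- its measurability is not needed.
  rw [lintegral_const_mul' _ _ ENNReal.ofReal_ne_top, lintegral_add_left (by fun_prop),
    lintegral_add_left (by fun_prop), lintegral_const_mul' _ _ ENNReal.ofReal_ne_top,
    lintegral_const_mul' _ _ ENNReal.ofReal_ne_top, lintegral_const, measure_univ, mul_one]
  calc _ ≤ ENNReal.ofReal (‖u‖ ^ 2) * (ENNReal.ofReal (4 * B ^ 2 + 8) * ENNReal.ofReal (G ^ 4)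
        + ENNReal.ofReal (8 * G ^ 4 + 4 * L ^ 2)
        + ENNReal.ofReal (4 * B ^ 2) * ENNReal.ofReal (L ^ 2)) := by
        gcongr
        · exact h.grad_p_le x hx
        · exact h.hess_p_le x hx
    _ = ENNReal.ofReal ((Lbar B G L * ‖u‖) ^ 2) := by
        rw [← ENNReal.ofReal_mul (by positivity), ← ENNReal.ofReal_mul (by positivity),
          ← ENNReal.ofReal_add (by positivity) (by positivity),
          ← ENNReal.ofReal_add (by positivity) (by positivity),
          ← ENNReal.ofReal_mul (by positivity), mul_pow, Lbar_sq]
        congr 1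
        ring

lemma lintegral_stepEst_zero_le [SFinite μ] (h : Regular μ p Ft C U D δ B G L L₂) {x y : Vec d}
    (hx : x ∈ C) (hy : y ∈ C) :
    ∫⁻ q, ‖stepEst 0 p Ft x y q‖ₑ ^ 2 ∂(pairLaw μ p x y)
      ≤ ENNReal.ofReal ((Lbar B G L * ‖y - x‖) ^ 2) := by
  refine h.lintegral_pairLaw_le x y ?_ fun a =>
    h.lintegral_hessVecEst_zero_le (clampSeg_mem h.convex hx hy a) (y - x)
  exact (h.measurable_stepEst_zero measurable_const measurable_const measurable_id
    (fun _ => hx) fun _ => hy).enorm.pow_const 2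

/-- The second moment of the gradient estimator. -/
lemma lintegral_gradEst_le (h : Regular μ p Ft C U D δ B G L L₂) {x : Vec d} (hx : x ∈ C) :
    ∫⁻ z, ‖gradEst p Ft x z‖ₑ ^ 2 ∂(sampleLaw μ p x)
      ≤ ENNReal.ofReal ((1 + B) ^ 2 * G ^ 2) := by
  have hprob := h.prob x hx
  have hB := h.B_nonneg
  have hG := h.G_nonneg
  have hmeas : Measurable fun z => gradF (logDensity p) x z :=
    h.smooth_log.measurable_gradF_comp measurable_const measurable_id fun _ => h.subset hx
  have hsq : ∫⁻ z, ‖gradF (logDensity p) x z‖ₑ ^ 2 ∂(sampleLaw μ p x)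
      ≤ ENNReal.ofReal (G ^ 2) := by
    -- From the fourth to the second moment: the bound of a mean by a second moment is applied to
    -- the squared norm of the score.
    have h4 : ∫⁻ z, ‖‖gradF (logDensity p) x z‖ ^ 2‖ₑ ^ 2 ∂(sampleLaw μ p x)
        ≤ ENNReal.ofReal ((G ^ 2) ^ 2) := by
      rw [← pow_mul]
      simp only [enorm_pow, enorm_norm, ← pow_mul]
      exact h.grad_p_le x hx
    have hm : AEStronglyMeasurable (fun z => ‖gradF (logDensity p) x z‖ ^ 2)
        (sampleLaw μ p x) := (hmeas.norm.pow_const 2).aestronglyMeasurable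
    have h2 := integral_norm_le_of_lintegral_sq_le hm (sq_nonneg G) h4
    have hint := (memLp_two_of_lintegral_le hm h4).integrable one_le_two
    simp only [norm_pow, norm_norm] at h2
    have hL2 : MemLp (fun z => gradF (logDensity p) x z) 2 (sampleLaw μ p x) :=
      (memLp_two_iff_integrable_sq_norm hmeas.aestronglyMeasurable).2 hint
    rw [lintegral_enorm_sq_eq_ofReal hL2]
    exact ENNReal.ofReal_le_ofReal h2
  have hpt : ∀ z, ‖gradEst p Ft x z‖ₑ ^ 2 ≤ ENNReal.ofReal ((1 + B) * G ^ 2)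
      + ENNReal.ofReal ((1 + B) * B) * ‖gradF (logDensity p) x z‖ₑ ^ 2 := by
    intro z
    rw [← ofReal_norm, ← ofReal_norm, ← ENNReal.ofReal_pow (norm_nonneg _),
      ← ENNReal.ofReal_pow (norm_nonneg _), ← ENNReal.ofReal_mul (by positivity),
      ← ENNReal.ofReal_add (by positivity) (by positivity)]
    refine ENNReal.ofReal_le_ofReal ?_
    have h1 : ‖gradEst p Ft x z‖ ≤ G + B * ‖gradF (logDensity p) x z‖ := by
      refine (norm_add_le _ _).trans ?_
      rw [norm_smul, Real.norm_eq_abs]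
      gcongr
      · exact h.grad_Ft_le x hx z
      · exact h.Ft_le x hx z
    calc ‖gradEst p Ft x z‖ ^ 2 ≤ (G + B * ‖gradF (logDensity p) x z‖) ^ 2 := by gcongr
      -- The two sides differ by B(G - ‖∇log p‖)².
      _ ≤ _ := by nlinarith [mul_nonneg hB (sq_nonneg (G - ‖gradF (logDensity p) x z‖))]
  refine (lintegral_mono hpt).trans ?_
  rw [lintegral_add_left (by fun_prop), lintegral_const_mul' _ _ ENNReal.ofReal_ne_top,
    lintegral_const, measure_univ, mul_one]
  calc _ ≤ ENNReal.ofReal ((1 + B) * G ^ 2)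
        + ENNReal.ofReal ((1 + B) * B) * ENNReal.ofReal (G ^ 2) := by gcongr
    _ = _ := by
        rw [← ENNReal.ofReal_mul (by positivity),
          ← ENNReal.ofReal_add (by positivity) (by positivity)]
        congr 1
        ring

end Regular

end

/-! ### Unbiasedness, smoothness of the objective, and one step of the error recursion. -/

section

variable {d : ℕ} {Z W : Type*} [MeasurableSpace Z] [MeasurableSpace W]

namespace Regular

variable {μ : Measure Z} {p Ft : Vec d → Z → ℝ} {C U : Set (Vec d)} {D δ B G L L₂ : ℝ}

lemma memLp_gradEst (h : Regular μ p Ft C U D δ B G L L₂) {x : Vec d} (hx : x ∈ C) :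
    MemLp (gradEst p Ft x) 2 (sampleLaw μ p x) :=
  memLp_two_of_lintegral_le
    (h.measurable_gradEst measurable_const measurable_id fun _ => hx).aestronglyMeasurable
    (h.lintegral_gradEst_le hx)

lemma integrable_gradEst (h : Regular μ p Ft C U D δ B G L L₂) {x : Vec d} (hx : x ∈ C) :
    Integrable (gradEst p Ft x) (sampleLaw μ p x) :=
  have := h.prob x hx
  (h.memLp_gradEst hx).integrable one_le_two

lemma integrable_Ft (h : Regular μ p Ft C U D δ B G L L₂) {x : Vec d} (hx : x ∈ C) :
    Integrable (Ft x) (sampleLaw μ p x) :=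
  have := h.prob x hx
  .of_bound (h.smooth_Ft.measurable_comp measurable_const measurable_id).aestronglyMeasurable B
    (.of_forall fun z => h.Ft_le x hx z)

lemma abs_objective_le (h : Regular μ p Ft C U D δ B G L L₂) {x : Vec d} (hx : x ∈ C) :
    |objective μ p Ft x| ≤ B := by
  have := h.prob x hx
  have := norm_integral_le_of_norm_le_const (μ := sampleLaw μ p x) (f := Ft x)
    (.of_forall fun z => h.Ft_le x hx z)
  simpa [objective] using this

lemma memLp_stepEst_zero [SFinite μ] (h : Regular μ p Ft C U D δ B G L L₂) {x y : Vec d}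
    (hx : x ∈ C) (hy : y ∈ C) : MemLp (stepEst 0 p Ft x y) 2 (pairLaw μ p x y) :=
  memLp_two_of_lintegral_le (h.measurable_stepEst_zero measurable_const measurable_const
    measurable_id (fun _ => hx) fun _ => hy).aestronglyMeasurable
    (h.lintegral_stepEst_zero_le hx hy)

lemma integrable_stepEst_zero [SFinite μ] (h : Regular μ p Ft C U D δ B G L L₂) {x y : Vec d}
    (hx : x ∈ C) (hy : y ∈ C) : Integrable (stepEst 0 p Ft x y) (pairLaw μ p x y) :=
  have := h.isProbabilityMeasure_pairLaw hx hy
  (h.memLp_stepEst_zero hx hy).integrable one_le_two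

lemma hasDerivAt_mul_Ft (h : Regular μ p Ft C U D δ B G L L₂) {x y : Vec d}
    {a : ℝ} (ha : segPoint x y a ∈ C) (z : Z) :
    HasDerivAt (fun a => p (segPoint x y a) z * Ft (segPoint x y a) z)
      (p (segPoint x y a) z * inner ℝ (gradEst p Ft (segPoint x y a) z) (y - x)) a := by
  have hU := h.subset ha
  have := (h.smooth_p.hasDerivAt_segPoint hU z).mul (h.smooth_Ft.hasDerivAt_segPoint hU z)
  convert! this using 1
  rw [h.smooth_p.gradF_eq_smul_gradF_log h.pos hU z, gradEst]
  simp only [inner_add_left, real_inner_smul_left]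
  ring

/-- The product rule for p∇Ft + p Ft ∇log p, with ∇p = p∇log p, produces precisely the five terms of
the Hessian estimator. This is the source of its unbiasedness. -/
lemma hasDerivAt_smul_gradEst (h : Regular μ p Ft C U D δ B G L L₂) {x y : Vec d}
    {a : ℝ} (ha : segPoint x y a ∈ C) (z : Z) :
    HasDerivAt (fun a => p (segPoint x y a) z • gradEst p Ft (segPoint x y a) z)
      (p (segPoint x y a) z • hessVecEst 0 p Ft (segPoint x y a) z (y - x)) a := by
  have hU := h.subset ha
  have := (h.smooth_p.hasDerivAt_segPoint hU z).smul
    ((h.smooth_Ft.hasDerivAt_gradF_segPoint hU z).add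
      ((h.smooth_Ft.hasDerivAt_segPoint hU z).smul
        (h.smooth_log.hasDerivAt_gradF_segPoint hU z)))
  convert! this using 1
  rw [h.smooth_p.gradF_eq_smul_gradF_log h.pos hU z]
  simp only [hessVecEst, hessVec, if_true, real_inner_smul_left, Pi.smul_apply', Pi.add_apply]
  module

lemma segPoint_zero (x y : Vec d) : segPoint x y 0 = x := by simp [segPoint]

lemma segPoint_one (x y : Vec d) : segPoint x y 1 = y := by simp [segPoint]

lemma segPoint_mem (h : Regular μ p Ft C U D δ B G L L₂) {x y : Vec d} (hx : x ∈ C) (hy : y ∈ C)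
    {a : ℝ} (ha : a ∈ Icc (0 : ℝ) 1) : segPoint x y a ∈ C := by
  rw [← clampSeg_of_mem x y ha]
  exact clampSeg_mem h.convex hx hy a

/-- The Hessian estimator is an unbiased estimator of the gradient difference. -/
lemma integral_stepEst_zero [SFinite μ] (h : Regular μ p Ft C U D δ B G L L₂) {x y : Vec d}
    (hx : x ∈ C) (hy : y ∈ C) :
    ∫ q, stepEst 0 p Ft x y q ∂(pairLaw μ p x y) = meanGrad μ p Ft y - meanGrad μ p Ft x := by
  have hint := (h.integrable_pairLaw_iff hx hy _).1 (h.integrable_stepEst_zero hx hy)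
  have := integral_sub_eq_integral_prod_deriv (μ := μ)
    (f := fun a z => p (segPoint x y a) z • gradEst p Ft (segPoint x y a) z)
    (f' := fun a z => p (clampSeg x y a) z • stepEst 0 p Ft x y (a, z))
    (fun z a ha => by
      rw [stepEst, clampSeg_of_mem x y ha]
      exact h.hasDerivAt_smul_gradEst (h.segPoint_mem hx hy ha) z) hint
    (by simpa only [segPoint_zero] using
      (h.integrable_sampleLaw_iff hx _).1 (h.integrable_gradEst hx))
    (by simpa only [segPoint_one] using
      (h.integrable_sampleLaw_iff hy _).1 (h.integrable_gradEst hy))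
  rw [h.integral_pairLaw hx hy, meanGrad, meanGrad, h.integral_sampleLaw hx,
    h.integral_sampleLaw hy]
  simp only [segPoint_zero, segPoint_one] at this
  exact this.symm

lemma lintegral_gradEst_pair_le [SFinite μ] (h : Regular μ p Ft C U D δ B G L L₂) {x y : Vec d}
    (hx : x ∈ C) (hy : y ∈ C) :
    ∫⁻ q : ℝ × Z, ‖gradEst p Ft (clampSeg x y q.1) q.2‖ₑ ^ 2 ∂(pairLaw μ p x y)
      ≤ ENNReal.ofReal ((1 + B) ^ 2 * G ^ 2) := by
  refine h.lintegral_pairLaw_le x y ?_ fun a =>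
    h.lintegral_gradEst_le (clampSeg_mem h.convex hx hy a)
  exact (h.measurable_gradEst (y := fun q : ℝ × Z => clampSeg x y q.1) (by fun_prop)
    measurable_snd fun q => clampSeg_mem h.convex hx hy q.1).enorm.pow_const 2

lemma integrable_inner_gradEst_pair [SFinite μ] (h : Regular μ p Ft C U D δ B G L L₂)
    {x y : Vec d} (hx : x ∈ C) (hy : y ∈ C) (u : Vec d) :
    Integrable (fun q : ℝ × Z => inner ℝ (gradEst p Ft (clampSeg x y q.1) q.2) u)
      (pairLaw μ p x y) := by
  have := h.isProbabilityMeasure_pairLaw hx hy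
  have hm : Measurable fun q : ℝ × Z => gradEst p Ft (clampSeg x y q.1) q.2 :=
    h.measurable_gradEst (by fun_prop) measurable_snd fun q => clampSeg_mem h.convex hx hy q.1
  exact ((memLp_two_of_lintegral_le hm.aestronglyMeasurable
    (h.lintegral_gradEst_pair_le hx hy)).integrable one_le_two).inner_const u

/-- The fundamental theorem of calculus for the objective, along segments in `C`. -/
lemma objective_sub_eq [SFinite μ] (h : Regular μ p Ft C U D δ B G L L₂) {x y : Vec d}
    (hx : x ∈ C) (hy : y ∈ C) :
    IntegrableOn (fun a => inner ℝ (meanGrad μ p Ft (clampSeg x y a)) (y - x)) (Icc 0 1) ∧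
    objective μ p Ft y - objective μ p Ft x
      = ∫ a in Icc (0 : ℝ) 1, inner ℝ (meanGrad μ p Ft (clampSeg x y a)) (y - x) := by
  have hint := (h.integrable_pairLaw_iff hx hy _).1 (h.integrable_inner_gradEst_pair hx hy (y - x))
  have := integral_sub_eq_integral_prod_deriv (μ := μ)
    (f := fun a z => p (segPoint x y a) z * Ft (segPoint x y a) z)
    (f' := fun a z => p (clampSeg x y a) z • inner ℝ (gradEst p Ft (clampSeg x y a) z) (y - x))
    (fun z a ha => by
      rw [clampSeg_of_mem x y ha]
      exact h.hasDerivAt_mul_Ft (h.segPoint_mem hx hy ha) z) hint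
    (by simpa only [segPoint_zero, smul_eq_mul] using
      (h.integrable_sampleLaw_iff hx _).1 (h.integrable_Ft hx))
    (by simpa only [segPoint_one, smul_eq_mul] using
      (h.integrable_sampleLaw_iff hy _).1 (h.integrable_Ft hy))
  simp only [segPoint_zero, segPoint_one] at this
  have hinner : ∀ a, ∫ z, p (clampSeg x y a) z •
      inner ℝ (gradEst p Ft (clampSeg x y a) z) (y - x) ∂μ
        = inner ℝ (meanGrad μ p Ft (clampSeg x y a)) (y - x) := by
    intro a
    have ha := clampSeg_mem h.convex hx hy a
    rw [← h.integral_sampleLaw ha, real_inner_comm, meanGrad, ← integral_inner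
      (h.integrable_gradEst ha)]
    simp only [real_inner_comm]
  constructor
  · have := hint.integral_prod_left
    simp only [hinner] at this
    exact this
  · rw [objective, objective, h.integral_sampleLaw hx, h.integral_sampleLaw hy]
    simp only [smul_eq_mul]
    rw [this, integral_prod _ hint]
    simp only [hinner]

/-- The mean gradient is Lipschitz on `C`. -/
lemma norm_meanGrad_sub_le [SFinite μ] (h : Regular μ p Ft C U D δ B G L L₂) {x y : Vec d}
    (hx : x ∈ C) (hy : y ∈ C) :
    ‖meanGrad μ p Ft y - meanGrad μ p Ft x‖ ≤ Lbar B G L * ‖y - x‖ := by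
  have := h.isProbabilityMeasure_pairLaw hx hy
  rw [← h.integral_stepEst_zero hx hy]
  exact (norm_integral_le_integral_norm _).trans (integral_norm_le_of_lintegral_sq_le
    (h.memLp_stepEst_zero hx hy).1 (mul_nonneg (Lbar_nonneg _ _ _) (norm_nonneg _))
    (h.lintegral_stepEst_zero_le hx hy))

/-- The quadratic bound for the first-order expansion of the objective. -/
lemma abs_objective_sub_sub_le [SFinite μ] (h : Regular μ p Ft C U D δ B G L L₂) {x y : Vec d}
    (hx : x ∈ C) (hy : y ∈ C) :
    |objective μ p Ft y - objective μ p Ft x - inner ℝ (meanGrad μ p Ft x) (y - x)|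
      ≤ Lbar B G L / 2 * ‖y - x‖ ^ 2 := by
  obtain ⟨hint, heq⟩ := h.objective_sub_eq hx hy
  have hconst : inner ℝ (meanGrad μ p Ft x) (y - x)
      = ∫ _ in Icc (0 : ℝ) 1, inner ℝ (meanGrad μ p Ft x) (y - x) := by simp
  rw [heq, hconst, ← integral_sub hint (by simp)]
  have hlin : ∫ a in Icc (0 : ℝ) 1, a * (Lbar B G L * ‖y - x‖ ^ 2)
      = Lbar B G L / 2 * ‖y - x‖ ^ 2 := by
    rw [integral_mul_const, integral_Icc_eq_integral_Ioc,
      ← intervalIntegral.integral_of_le zero_le_one, integral_id]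
    ring
  rw [← hlin, ← Real.norm_eq_abs]
  refine norm_integral_le_of_norm_le
    ((continuous_id.mul continuous_const).continuousOn.integrableOn_Icc) ?_
  refine (ae_restrict_iff' measurableSet_Icc).2 (.of_forall fun a ha => ?_)
  rw [← inner_sub_left]
  refine (norm_inner_le_norm _ _).trans ?_
  calc _ ≤ Lbar B G L * ‖clampSeg x y a - x‖ * ‖y - x‖ := by
        gcongr
        exact h.norm_meanGrad_sub_le hx (clampSeg_mem h.convex hx hy a)
    _ = _ := by
        rw [clampSeg_of_mem x y ha, segPoint_sub, norm_smul, Real.norm_of_nonneg ha.1]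
        ring

/-- The error of the symmetric difference quotient of gradients. -/
lemma norm_hessVec_sub_le (h : Regular μ p Ft C U D δ B G L L₂) {f : Vec d → Z → ℝ}
    (hf : SmoothFamily U f)
    (hlip : ∀ c ∈ C, ∀ x ∈ Metric.closedBall c (δ * D), ∀ z,
      ‖hessF f x z - hessF f c z‖ ≤ L₂ * ‖x - c‖)
    {c u : Vec d} (hc : c ∈ C) (hu : ‖u‖ ≤ D) (z : Z) :
    ‖hessVec δ f c z u - hessVec 0 f c z u‖ ≤ L₂ * δ * ‖u‖ ^ 2 := by
  rcases h.δ_nonneg.eq_or_lt with hδ | hδ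
  · simp [← hδ]
  have hL₂ := h.L₂_nonneg
  -- The mean value inequality is used on the ball of radius δ‖u‖ rather than δD; this makes the
  -- error quadratic in ‖u‖.
  have hsub : Metric.closedBall c (δ * ‖u‖) ⊆ Metric.closedBall c (δ * D) :=
    Metric.closedBall_subset_closedBall (by gcongr)
  have hmem : ∀ s : ℝ, |s| ≤ δ → c + s • u ∈ Metric.closedBall c (δ * ‖u‖) := by
    intro s hs
    rw [mem_closedBall_iff_norm, add_sub_cancel_left, norm_smul, Real.norm_eq_abs]
    gcongr
  have key := (convex_closedBall c (δ * ‖u‖)).norm_image_sub_le_of_norm_hasFDerivWithin_le'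
    (f := fun y => gradF f y z) (f' := fun y => hessF f y z) (φ := hessF f c z)
    (C := L₂ * (δ * ‖u‖))
    (fun x hx => (hf.hasFDerivAt_gradF (h.ball c hc (hsub hx)) z).hasFDerivWithinAt)
    (fun x hx => (hlip c hc x (hsub hx) z).trans (by
      gcongr
      rwa [mem_closedBall_iff_norm] at hx))
    (hmem (-δ) (by rw [abs_neg, abs_of_pos hδ])) (hmem δ (by rw [abs_of_pos hδ]))
  have h2 : c + δ • u - (c + (-δ) • u) = (2 * δ) • u := by module
  have h3 : c + (-δ) • u = c - δ • u := by module
  rw [h2, h3, map_smul, norm_smul, Real.norm_of_nonneg (by positivity)] at key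
  have h4 : hessVec δ f c z u - hessVec 0 f c z u = (2 * δ)⁻¹ •
      (gradF f (c + δ • u) z - gradF f (c - δ • u) z - (2 * δ) • hessF f c z u) := by
    rw [smul_sub _ _ ((2 * δ) • _), inv_smul_smul₀ (by positivity)]
    simp [hessVec, hδ.ne']
  rw [h4, norm_smul, Real.norm_of_nonneg (by positivity), inv_mul_le_iff₀ (by positivity)]
  linarith

/-- The error of the Hessian estimator due to the difference quotients. -/
lemma norm_stepEst_sub_le (h : Regular μ p Ft C U D δ B G L L₂) {x y : Vec d}
    (hx : x ∈ C) (hy : y ∈ C) (hD : ‖y - x‖ ≤ D) (q : ℝ × Z) :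
    ‖stepEst δ p Ft x y q - stepEst 0 p Ft x y q‖ ≤ (1 + B) * (L₂ * δ * ‖y - x‖ ^ 2) := by
  have hc := clampSeg_mem h.convex hx hy q.1
  have h1 := h.norm_hessVec_sub_le h.smooth_Ft h.lip_Ft hc hD q.2
  have h2 := h.norm_hessVec_sub_le h.smooth_log h.lip_p hc hD q.2
  have h3 : stepEst δ p Ft x y q - stepEst 0 p Ft x y q
      = (hessVec δ Ft (clampSeg x y q.1) q.2 (y - x) - hessVec 0 Ft (clampSeg x y q.1) q.2 (y - x))
        + Ft (clampSeg x y q.1) q.2 • (hessVec δ (logDensity p) (clampSeg x y q.1) q.2 (y - x)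
          - hessVec 0 (logDensity p) (clampSeg x y q.1) q.2 (y - x)) := by
    rw [stepEst, stepEst, hessVecEst, hessVecEst]
    module
  rw [h3]
  refine (norm_add_le _ _).trans ?_
  rw [norm_smul, Real.norm_eq_abs, add_mul, one_mul]
  gcongr
  · exact h.B_nonneg
  · exact h.Ft_le _ hc _

/-- Young's inequality. The weight c = 1/3 serves the second moment of the difference estimator, c =
1/(4T) the growth of the error. -/
lemma sq_add_le_mul {a b c : ℝ} (hc : 0 < c) :
    (a + b) ^ 2 ≤ (1 + c) * a ^ 2 + (1 + c⁻¹) * b ^ 2 := by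
  have h1 : 0 ≤ c⁻¹ * (c * a - b) ^ 2 := by positivity
  have h2 : c⁻¹ * (c * a - b) ^ 2 = c * a ^ 2 - 2 * a * b + c⁻¹ * b ^ 2 := by
    field_simp
    ring
  linarith

/-- One step of the error recursion, given the past: the error `e` of the gradient estimate at
`x` turns into the error at `y`. -/
lemma lintegral_step_le [SFinite μ] (h : Regular μ p Ft C U D δ B G L L₂) {T m : ℕ}
    (hT : 1 ≤ T) (hm : 2 * T ≤ m) (hδ : 3 * (1 + B) * L₂ * D * δ ≤ Lbar B G L)
    {x y : Vec d} (hx : x ∈ C) (hy : y ∈ C) (hxy : ‖y - x‖ ≤ D / T) (e : Vec d) :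
    ∫⁻ s, ‖e - (meanGrad μ p Ft y - meanGrad μ p Ft x)
        + (m : ℝ)⁻¹ • ∑ k, stepEst δ p Ft x y (s k)‖ₑ ^ 2
        ∂(Measure.pi fun _ : Fin m => pairLaw μ p x y)
      ≤ ENNReal.ofReal ((1 + (4 * T : ℝ)⁻¹) * ‖e‖ ^ 2 + (13 / 9) * (Lbar B G L * D / T) ^ 2 / T) := by
  have := h.isProbabilityMeasure_pairLaw hx hy
  have hLb := Lbar_nonneg B G L
  have hD := h.D_nonneg
  have hB := h.B_nonneg
  have hL₂ := h.L₂_nonneg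
  have hδ0 := h.δ_nonneg
  have hT0 : (0 : ℝ) < T := by positivity
  have hT1 : (1 : ℝ) ≤ T := by exact_mod_cast hT
  have hm0 : (0 : ℝ) < m := by
    have : 0 < m := by omega
    positivity
  have hm2 : 2 * (T : ℝ) ≤ m := by exact_mod_cast hm
  have hxyD : ‖y - x‖ ≤ D := hxy.trans (div_le_self hD hT1)
  set A := Lbar B G L * D / T with hA
  have hA0 : 0 ≤ A := by positivity
  -- The smallness condition on δ is calibrated here: (1 + B)L₂δ(D/T)² ≤ L̄D/(3T²) = A/(3T).
  have hdiff : ∀ q, ‖stepEst δ p Ft x y q - stepEst 0 p Ft x y q‖ ≤ A / (3 * T) := by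
    intro q
    refine (h.norm_stepEst_sub_le hx hy hxyD q).trans ?_
    calc (1 + B) * (L₂ * δ * ‖y - x‖ ^ 2) ≤ (1 + B) * (L₂ * δ * (D / T) ^ 2) := by gcongr
      _ = 3 * (1 + B) * L₂ * D * δ * (D / (3 * T ^ 2)) := by field_simp
      _ ≤ Lbar B G L * (D / (3 * T ^ 2)) := by gcongr
      _ = A / (3 * T) := by rw [hA]; field_simp
  have hmeas : Measurable (stepEst δ p Ft x y) :=
    h.measurable_stepEst measurable_const measurable_const measurable_id (fun _ => hx)
      (fun _ => hy) fun _ => hxyD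
  have hmeas0 : Measurable (stepEst 0 p Ft x y) :=
    h.measurable_stepEst_zero measurable_const measurable_const measurable_id (fun _ => hx)
      fun _ => hy
  have hV0 := h.lintegral_stepEst_zero_le hx hy
  -- With c = 1/3 in Young's inequality, 16/9 = 4/3 + 4 · (1/3)².
  have hV : ∫⁻ q, ‖stepEst δ p Ft x y q‖ₑ ^ 2 ∂(pairLaw μ p x y)
      ≤ ENNReal.ofReal (16 / 9 * A ^ 2) := by
    have hpt : ∀ q, ‖stepEst δ p Ft x y q‖ₑ ^ 2 ≤ ENNReal.ofReal (4 / 3) *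
        ‖stepEst 0 p Ft x y q‖ₑ ^ 2 + ENNReal.ofReal (4 / 9 * A ^ 2) := by
      intro q
      rw [← ofReal_norm, ← ofReal_norm, ← ENNReal.ofReal_pow (norm_nonneg _),
        ← ENNReal.ofReal_pow (norm_nonneg _), ← ENNReal.ofReal_mul (by positivity),
        ← ENNReal.ofReal_add (by positivity) (by positivity)]
      refine ENNReal.ofReal_le_ofReal ?_
      have h1 : ‖stepEst δ p Ft x y q‖ ≤ ‖stepEst 0 p Ft x y q‖ + A / 3 := by
        have h2 := norm_sub_norm_le (stepEst δ p Ft x y q) (stepEst 0 p Ft x y q)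
        have h3 : A / (3 * T) ≤ A / 3 := by
          gcongr
          linarith
        linarith [hdiff q]
      calc _ ≤ (‖stepEst 0 p Ft x y q‖ + A / 3) ^ 2 := by gcongr
        _ ≤ _ := sq_add_le_mul (c := 1 / 3) (by norm_num)
        _ = _ := by ring
    refine (lintegral_mono hpt).trans ?_
    rw [lintegral_add_left (by fun_prop), lintegral_const_mul' _ _ ENNReal.ofReal_ne_top,
      lintegral_const, measure_univ, mul_one]
    calc _ ≤ ENNReal.ofReal (4 / 3) * ENNReal.ofReal (A ^ 2) + ENNReal.ofReal (4 / 9 * A ^ 2) := by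
          gcongr
          refine hV0.trans (ENNReal.ofReal_le_ofReal ?_)
          calc (Lbar B G L * ‖y - x‖) ^ 2 ≤ (Lbar B G L * (D / T)) ^ 2 := by gcongr
            _ = A ^ 2 := by rw [hA]; ring
      _ = _ := by
          rw [← ENNReal.ofReal_mul (by positivity),
            ← ENNReal.ofReal_add (by positivity) (by positivity)]
          congr 1
          ring
  refine (lintegral_pi_average_le (by omega) (pairLaw μ p x y) hmeas (by positivity) hV _).trans ?_
  refine ENNReal.ofReal_le_ofReal ?_
  have hint : Integrable (stepEst δ p Ft x y) (pairLaw μ p x y) :=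
    (memLp_two_of_lintegral_le hmeas.aestronglyMeasurable hV).integrable one_le_two
  have hbias : ‖∫ q, stepEst δ p Ft x y q ∂(pairLaw μ p x y)
      - (meanGrad μ p Ft y - meanGrad μ p Ft x)‖ ≤ A / (3 * T) := by
    rw [← h.integral_stepEst_zero hx hy, ← integral_sub hint (h.integrable_stepEst_zero hx hy)]
    simpa using norm_integral_le_of_norm_le_const (μ := pairLaw μ p x y) (.of_forall hdiff)
  have h1 : ‖e - (meanGrad μ p Ft y - meanGrad μ p Ft x)
      + ∫ q, stepEst δ p Ft x y q ∂(pairLaw μ p x y)‖ ≤ ‖e‖ + A / (3 * T) := by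
    have : e - (meanGrad μ p Ft y - meanGrad μ p Ft x)
      + ∫ q, stepEst δ p Ft x y q ∂(pairLaw μ p x y) = e +
        (∫ q, stepEst δ p Ft x y q ∂(pairLaw μ p x y)
          - (meanGrad μ p Ft y - meanGrad μ p Ft x)) := by abel
    rw [this]
    exact (norm_add_le _ _).trans (by gcongr)
  -- Weight 1/(4T) keeps the growth over T steps bounded; its cost (1 + 4T)A²/(9T²) is at most
  -- 5A²/(9T). The variance adds 16A²/(9m) ≤ 8A²/(9T), for a total of 13A²/(9T).
  have h2 : ‖e - (meanGrad μ p Ft y - meanGrad μ p Ft x)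
      + ∫ q, stepEst δ p Ft x y q ∂(pairLaw μ p x y)‖ ^ 2
      ≤ (1 + (4 * T : ℝ)⁻¹) * ‖e‖ ^ 2 + (1 + 4 * T) * (A / (3 * T)) ^ 2 := by
    refine (pow_le_pow_left₀ (norm_nonneg _) h1 2).trans ?_
    simpa using sq_add_le_mul (a := ‖e‖) (b := A / (3 * T)) (c := (4 * T : ℝ)⁻¹) (by positivity)
  have h3 : (1 + 4 * (T : ℝ)) * (A / (3 * T)) ^ 2 ≤ 5 / 9 * A ^ 2 / T := by
    calc (1 + 4 * (T : ℝ)) * (A / (3 * T)) ^ 2 ≤ (5 * T) * (A / (3 * T)) ^ 2 := by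
          gcongr
          linarith
      _ = _ := by field_simp; ring
  have h4 : 16 / 9 * A ^ 2 / m ≤ 8 / 9 * A ^ 2 / T := by
    calc 16 / 9 * A ^ 2 / m ≤ 16 / 9 * A ^ 2 / (2 * T) := by gcongr
      _ = _ := by field_simp; ring
  have h5 : 13 / 9 * A ^ 2 / T = 5 / 9 * A ^ 2 / T + 8 / 9 * A ^ 2 / T := by ring
  linarith

end Regular

end

/-! ### Progress of one ascent step. -/

section

variable {d : ℕ} {Z : Type*} [MeasurableSpace Z]

/-- If `c` and `w` lie in a convex set, then moving from `(t / T) c` by `w / T` leads to a point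
`((t + 1) / T) c'` with `c'` in the set. -/
lemma exists_smul_add_smul_eq {C : Set (Vec d)} (hC : Convex ℝ C) {c w : Vec d} (hc : c ∈ C)
    (hw : w ∈ C) (t T : ℕ) :
    ∃ c' ∈ C, ((t : ℝ) / T) • c + (T : ℝ)⁻¹ • w = (((t + 1 : ℕ) : ℝ) / T) • c' := by
  have ht : ((t : ℝ) + 1) ≠ 0 := by positivity
  refine ⟨((t : ℝ) / (t + 1)) • c + ((t : ℝ) + 1)⁻¹ • w,
    hC hc hw (by positivity) (by positivity) (by field_simp), ?_⟩
  rw [smul_add, smul_smul, smul_smul]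
  push_cast
  congr 2 <;> field_simp

lemma smul_mem_of_le {C : Set (Vec d)} (hC : Convex ℝ C) (h0 : 0 ∈ C) {c : Vec d} (hc : c ∈ C)
    {t T : ℕ} (hT : 1 ≤ T) (ht : t ≤ T) : ((t : ℝ) / T) • c ∈ C := by
  have hT' : (0 : ℝ) < T := by positivity
  exact hC.smul_mem_of_zero_mem h0 hc
    ⟨by positivity, (div_le_one hT').2 (by exact_mod_cast ht)⟩

namespace Regular

variable {μ : Measure Z} {p Ft : Vec d → Z → ℝ} {C U : Set (Vec d)} {D δ B G L L₂ : ℝ}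

/-- For a DR-submodular objective, the first-order expansion in a nonnegative direction is an
upper bound. -/
lemma objective_add_sub_le [SFinite μ] (h : Regular μ p Ft C U D δ B G L L₂) {ubar : Vec d}
    (hF : DRSubmodularOn (objective μ p Ft) (box ubar)) (hC : C ⊆ box ubar) {x w : Vec d}
    (hx : x ∈ C) (hw : ∀ i, 0 ≤ w i) (hxw : x + w ∈ box ubar) {N : ℕ}
    (hN : ∀ n : ℕ, N ≤ n → x + (n : ℝ)⁻¹ • w ∈ C) :
    objective μ p Ft (x + w) - objective μ p Ft x ≤ inner ℝ (meanGrad μ p Ft x) w := by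
  -- The point x + w may lie outside C, where no expansion is available; x + w/n lies in C, and n
  -- times the quadratic remainder there vanishes as n → ∞.
  have key : ∀ n : ℕ, max N 1 ≤ n → objective μ p Ft (x + w) - objective μ p Ft x
      ≤ inner ℝ (meanGrad μ p Ft x) w + Lbar B G L / 2 * ‖w‖ ^ 2 * (n : ℝ)⁻¹ := by
    intro n hn
    have hn1 : 1 ≤ n := (le_max_right _ _).trans hn
    have hn0 : (0 : ℝ) < n := by positivity
    have h1 := hF.sub_le_nsmul (hC hx) hw hxw hn1
    have h2 := (abs_le.1 (h.abs_objective_sub_sub_le hx (hN n ((le_max_left _ _).trans hn)))).2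
    rw [add_sub_cancel_left, inner_smul_right, norm_smul, norm_inv, Real.norm_natCast] at h2
    refine h1.trans ?_
    calc (n : ℝ) * (objective μ p Ft (x + (n : ℝ)⁻¹ • w) - objective μ p Ft x)
        ≤ n * ((n : ℝ)⁻¹ * inner ℝ (meanGrad μ p Ft x) w
            + Lbar B G L / 2 * ((n : ℝ)⁻¹ * ‖w‖) ^ 2) := by
          gcongr
          linarith
      _ = _ := by field_simp
  have hlim : Filter.Tendsto (fun n : ℕ => inner ℝ (meanGrad μ p Ft x) w
      + Lbar B G L / 2 * ‖w‖ ^ 2 * (n : ℝ)⁻¹) Filter.atTop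
      (nhds (inner ℝ (meanGrad μ p Ft x) w + Lbar B G L / 2 * ‖w‖ ^ 2 * 0)) :=
    (tendsto_inv_atTop_nhds_zero_nat.const_mul _).const_add _
  rw [mul_zero, add_zero] at hlim
  exact ge_of_tendsto hlim (Filter.eventually_atTop.2 ⟨_, key⟩)

/-- The progress of one ascent step from `x` along a direction `v` that is maximal for the gradient
estimate `g`, in comparison with the direction `w` from `x` to `x ⊔ xs`. -/
lemma objective_step_ge [SFinite μ] (h : Regular μ p Ft C U D δ B G L L₂) {ubar : Vec d}
    (hF : DRSubmodularOn (objective μ p Ft) (box ubar))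
    (hF0 : ∀ x ∈ box ubar, 0 ≤ objective μ p Ft x) (hC : C ⊆ box ubar) (hdown : DownClosed C)
    {T : ℕ} (hT : 1 ≤ T) {x v g xs : Vec d} (hx : x ∈ C) (hxs : xs ∈ C) (hv : v ∈ C)
    (hadd : ∀ w ∈ C, x + (T : ℝ)⁻¹ • w ∈ C)
    (hmax : ∀ w ∈ C, (∀ i, w i ≤ ubar i - x i) → inner ℝ w g ≤ inner ℝ v g)
    {θ : ℝ} (hθ0 : 0 ≤ θ) (hθ1 : θ ≤ 1) (hxθ : ∀ i, x i ≤ θ * ubar i) :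
    (1 - (T : ℝ)⁻¹) * objective μ p Ft x + (T : ℝ)⁻¹ * ((1 - θ) * objective μ p Ft xs)
        - (T : ℝ)⁻¹ * (√2 * D * ‖g - meanGrad μ p Ft x‖) - Lbar B G L * D ^ 2 / (2 * T ^ 2)
      ≤ objective μ p Ft (x + (T : ℝ)⁻¹ • v) := by
  have hT0 : (0 : ℝ) < T := by positivity
  have hD := h.D_nonneg
  have hLb := Lbar_nonneg B G L
  set w := posSub xs x with hw
  have hxb := hC hx
  have hxsb := hC hxs
  have hw0 : ∀ i, 0 ≤ w i := fun i => le_max_right _ _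
  have hwxs : ∀ i, w i ≤ xs i := fun i => max_le (by linarith [(hxb i).1]) (hxsb i).1
  have hwC : w ∈ C := hdown xs hxs w fun i => ⟨hw0 i, hwxs i⟩
  have hwu : ∀ i, w i ≤ ubar i - x i := fun i =>
    max_le (by linarith [(hxsb i).2]) (by linarith [(hxb i).2])
  have hxw : x + w ∈ box ubar := fun i => by
    have := hwu i
    have := hw0 i
    have := hxb i
    simp only [PiLp.add_apply]
    constructor <;> linarith
  -- Since x + w/T ∈ C, down-closedness puts x + w/n in C for every n ≥ T.
  have hdir := h.objective_add_sub_le hF hC hx hw0 hxw (N := T) fun n hn => by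
    have hn' : (T : ℝ) ≤ n := by exact_mod_cast hn
    refine hdown _ (hadd w hwC) _ fun i => ?_
    have h1 : (n : ℝ)⁻¹ * w i ≤ (T : ℝ)⁻¹ * w i := by
      have := hw0 i
      gcongr
    have h2 : 0 ≤ (n : ℝ)⁻¹ * w i := mul_nonneg (by positivity) (hw0 i)
    have := hxb i
    simp only [PiLp.add_apply, PiLp.smul_apply, smul_eq_mul]
    constructor <;> linarith
  have hsup := hF.one_sub_mul_le_sup hF0 hxb hxsb hθ0 hθ1 hxθ
  have hquad := (abs_le.1 (h.abs_objective_sub_sub_le hx (hadd v hv))).1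
  rw [add_sub_cancel_left, inner_smul_right, norm_smul, norm_inv, Real.norm_natCast] at hquad
  have hvD : Lbar B G L / 2 * ((T : ℝ)⁻¹ * ‖v‖) ^ 2 ≤ Lbar B G L * D ^ 2 / (2 * T ^ 2) := by
    calc _ ≤ Lbar B G L / 2 * ((T : ℝ)⁻¹ * D) ^ 2 := by
          gcongr
          exact h.norm_le v hv
      _ = _ := by field_simp
  have hgw := hmax w hwC hwu
  -- Both vectors are nonnegative, so ⟨v, w⟩ ≥ 0 and ‖v - w‖² ≤ 2D²; the triangle inequality would
  -- only give 2D.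
  have hvw : ‖v - w‖ ≤ √2 * D := by
    refine Real.le_sqrt_of_sq_le ?_ |>.trans (le_of_eq ?_) (b := √(2 * D ^ 2))
    · rw [norm_sub_sq_real]
      have h1 : 0 ≤ inner ℝ v w := by
        rw [PiLp.inner_apply]
        exact Finset.sum_nonneg fun i _ => by
          simpa using mul_nonneg (hw0 i) (hC hv i).1
      have h2 : ‖v‖ ^ 2 ≤ D ^ 2 := by
        gcongr
        exact h.norm_le v hv
      have h3 : ‖w‖ ^ 2 ≤ D ^ 2 := by
        gcongr
        exact h.norm_le w hwC
      linarith
    · rw [Real.sqrt_mul zero_le_two, Real.sqrt_sq hD]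
  have herr : inner ℝ (g - meanGrad μ p Ft x) (v - w) ≤ √2 * D * ‖g - meanGrad μ p Ft x‖ := by
    refine (real_inner_le_norm _ _).trans ?_
    rw [mul_comm]
    gcongr
  have hmain : inner ℝ (meanGrad μ p Ft x) w - √2 * D * ‖g - meanGrad μ p Ft x‖
      ≤ inner ℝ (meanGrad μ p Ft x) v := by
    simp only [inner_sub_left, inner_sub_right] at herr
    rw [real_inner_comm w g, real_inner_comm v g] at herr
    linarith
  have hscaled : (T : ℝ)⁻¹ * ((1 - θ) * objective μ p Ft xs - objective μ p Ft x
      - √2 * D * ‖g - meanGrad μ p Ft x‖) ≤ (T : ℝ)⁻¹ * inner ℝ (meanGrad μ p Ft x) v := by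
    gcongr
    linarith
  linarith

/-- The mean gradient is measurable on `C`. -/
lemma measurable_meanGrad [SFinite μ] (h : Regular μ p Ft C U D δ B G L L₂) :
    Measurable fun c : C => meanGrad μ p Ft c := by
  have : LipschitzWith ⟨Lbar B G L, Lbar_nonneg B G L⟩ fun c : C => meanGrad μ p Ft c :=
    LipschitzWith.of_dist_le_mul fun c c' => by
      rw [dist_eq_norm, Subtype.dist_eq, dist_eq_norm]
      exact h.norm_meanGrad_sub_le c'.2 c.2
  exact this.continuous.measurable

/-- The objective is measurable on `C`. -/
lemma measurable_objective [SFinite μ] (h : Regular μ p Ft C U D δ B G L L₂) :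
    Measurable fun c : C => objective μ p Ft c := by
  have hm : StronglyMeasurable fun q : C × Z => p q.1 q.2 • Ft q.1 q.2 :=
    ((h.smooth_p.measurable_comp (by fun_prop) measurable_snd).smul
      (h.smooth_Ft.measurable_comp (by fun_prop) measurable_snd)).stronglyMeasurable
  have heq : (fun c : C => objective μ p Ft c) = fun c : C => ∫ z, p c z • Ft c z ∂μ :=
    funext fun c => h.integral_sampleLaw c.2 _
  rw [heq]
  exact (hm.integral_prod_right' (ν := μ)).measurable

end Regular

end

/-! ### Runs of the algorithm: feasibility, measurability and the mean square error. -/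

section

variable {d : ℕ} {Z : Type*} [MeasurableSpace Z]

/-- The pairs of consecutive iterates. -/
abbrev StepPair (C : Set (Vec d)) (D : ℝ) (T : ℕ) :=
  {w : Vec d × Vec d // w.1 ∈ C ∧ w.2 ∈ C ∧ ‖w.2 - w.1‖ ≤ D / T}

/-- The gradient estimates of a run, with the segments clamped to `[0, 1]`. -/
noncomputable def clampedEst {Ω : Type*} (δ : ℝ) (p Ft : Vec d → Z → ℝ) {m : ℕ}
    (b : ℕ → Ω → Fin m → ℝ × Z) (x : ℕ → Ω → Vec d) (g₀ : Ω → Vec d) : ℕ → Ω → Vec d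
  | 0, ω => g₀ ω
  | t + 1, ω => clampedEst δ p Ft b x g₀ t ω
      + (m : ℝ)⁻¹ • ∑ k, stepEst δ p Ft (x t ω) (x (t + 1) ω) (b (t + 1) ω k)

/-- The square norm of the error of the new gradient estimate, as a function of the pair of
iterates, of the error of the old estimate, and of the batch. -/
noncomputable def stepError (μ : Measure Z) (δ : ℝ) (p Ft : Vec d → Z → ℝ) {C : Set (Vec d)}
    {D : ℝ} {T m : ℕ} (r : (StepPair C D T × Vec d) × (Fin m → ℝ × Z)) : ℝ≥0∞ :=
  ‖r.1.2 - (meanGrad μ p Ft r.1.1.1.2 - meanGrad μ p Ft r.1.1.1.1)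
    + (m : ℝ)⁻¹ • ∑ k, stepEst δ p Ft r.1.1.1.1 r.1.1.1.2 (r.2 k)‖ₑ ^ 2

namespace Regular

variable {μ : Measure Z} {p Ft : Vec d → Z → ℝ} {C U : Set (Vec d)} {D δ B G L L₂ : ℝ}

lemma measurable_pairLaw [SFinite μ] (h : Regular μ p Ft C U D δ B G L L₂) (T : ℕ) :
    Measurable fun w : StepPair C D T => pairLaw μ p w.1.1 w.1.2 := by
  refine Measure.measurable_of_measurable_coe _ fun S hS => ?_
  simp only [pairLaw_eq_clamp, withDensity_apply _ hS, ← lintegral_indicator hS]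
  have hm : Measurable fun r : StepPair C D T × (ℝ × Z) =>
      ENNReal.ofReal (p (clampSeg r.1.1.1 r.1.1.2 r.2.1) r.2.2) :=
    h.measurable_density (by fun_prop) (by fun_prop)
  exact (hm.indicator (measurable_snd hS)).lintegral_prod_right'

lemma norm_sub_le_of_stepPair (h : Regular μ p Ft C U D δ B G L L₂) {T : ℕ} (hT : 1 ≤ T)
    (w : StepPair C D T) : ‖w.1.2 - w.1.1‖ ≤ D :=
  w.2.2.2.trans (div_le_self h.D_nonneg (by exact_mod_cast hT))

lemma measurable_stepPair_stepEst (h : Regular μ p Ft C U D δ B G L L₂) {T : ℕ} (hT : 1 ≤ T) :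
    Measurable fun r : StepPair C D T × (ℝ × Z) => stepEst δ p Ft r.1.1.1 r.1.1.2 r.2 :=
  h.measurable_stepEst (by fun_prop) (by fun_prop) measurable_snd (fun r => r.1.2.1)
    (fun r => r.1.2.2.1) fun r => h.norm_sub_le_of_stepPair hT r.1

lemma measurable_stepError [SFinite μ] (h : Regular μ p Ft C U D δ B G L L₂) {T m : ℕ}
    (hT : 1 ≤ T) :
    Measurable fun r : (StepPair C D T × Vec d) × (Fin m → ℝ × Z) => stepError μ δ p Ft r := by
  have hm1 : Measurable fun w : StepPair C D T => meanGrad μ p Ft w.1.1 :=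
    h.measurable_meanGrad.comp (g := fun c : C => meanGrad μ p Ft c)
      (f := fun w : StepPair C D T => ⟨w.1.1, w.2.1⟩)
      (Measurable.subtype_mk (measurable_fst.comp measurable_subtype_coe))
  have hm2 : Measurable fun w : StepPair C D T => meanGrad μ p Ft w.1.2 :=
    h.measurable_meanGrad.comp (g := fun c : C => meanGrad μ p Ft c)
      (f := fun w : StepPair C D T => ⟨w.1.2, w.2.2.1⟩)
      (Measurable.subtype_mk (measurable_snd.comp measurable_subtype_coe))
  have hm3 : ∀ k, Measurable fun r : (StepPair C D T × Vec d) × (Fin m → ℝ × Z) =>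
      stepEst δ p Ft r.1.1.1.1 r.1.1.1.2 (r.2 k) := fun k =>
    (h.measurable_stepPair_stepEst hT).comp (g := fun r : StepPair C D T × (ℝ × Z) =>
      stepEst δ p Ft r.1.1.1 r.1.1.2 r.2)
      (f := fun r : (StepPair C D T × Vec d) × (Fin m → ℝ × Z) => (r.1.1, r.2 k))
      (by fun_prop)
  have hw : Measurable fun r : (StepPair C D T × Vec d) × (Fin m → ℝ × Z) => r.1.1 :=
    measurable_fst.comp measurable_fst
  exact (((measurable_snd.comp measurable_fst).sub ((hm2.comp hw).sub (hm1.comp hw))).add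
    ((Finset.measurable_sum _ fun k _ => hm3 k).const_smul ((m : ℝ)⁻¹))).enorm.pow_const 2

end Regular

namespace IsRun

variable {μ : Measure Z} {p Ft : Vec d → Z → ℝ} {C U : Set (Vec d)} {ubar : Vec d}
  {D δ B G L L₂ : ℝ} {T m₀ m : ℕ} {Ω : Type*} [MeasurableSpace Ω] {P : Measure Ω}
  {ℱ : Filtration ℕ (inferInstance : MeasurableSpace Ω)}
  {z₀ : Ω → Fin m₀ → Z} {b : ℕ → Ω → Fin m → ℝ × Z} {x g v : ℕ → Ω → Vec d}

/-- The iterate is 1/T times a sum of t elements of C. For t < T this leaves room for a further step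
along any element of C, in particular along the comparison direction. -/
lemma exists_eq_smul (hrun : IsRun P μ p Ft C ubar T m₀ m δ ℱ z₀ b x g v)
    (hC : Convex ℝ C) (h0 : 0 ∈ C) {t : ℕ} (ht : t ≤ T) (ω : Ω) :
    ∃ c ∈ C, x t ω = ((t : ℝ) / T) • c := by
  induction t with
  | zero => exact ⟨0, h0, by simp [hrun.x_zero]⟩
  | succ t ih =>
    obtain ⟨c, hc, hxc⟩ := ih (by omega)
    obtain ⟨c', hc', heq⟩ := exists_smul_add_smul_eq hC hc (hrun.v_mem t ht ω).1 t T
    exact ⟨c', hc', by rw [hrun.x_succ t ht, hxc, heq]⟩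

lemma mem (hrun : IsRun P μ p Ft C ubar T m₀ m δ ℱ z₀ b x g v)
    (hC : Convex ℝ C) (h0 : 0 ∈ C) (hT : 1 ≤ T) {t : ℕ} (ht : t ≤ T) (ω : Ω) : x t ω ∈ C := by
  obtain ⟨c, hc, hxc⟩ := hrun.exists_eq_smul hC h0 ht ω
  rw [hxc]
  exact smul_mem_of_le hC h0 hc hT ht

lemma add_smul_mem (hrun : IsRun P μ p Ft C ubar T m₀ m δ ℱ z₀ b x g v)
    (hC : Convex ℝ C) (h0 : 0 ∈ C) (hT : 1 ≤ T) {t : ℕ} (ht : t < T) (ω : Ω) {w : Vec d}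
    (hw : w ∈ C) : x t ω + (T : ℝ)⁻¹ • w ∈ C := by
  obtain ⟨c, hc, hxc⟩ := hrun.exists_eq_smul hC h0 ht.le ω
  obtain ⟨c', hc', heq⟩ := exists_smul_add_smul_eq hC hc hw t T
  rw [hxc, heq]
  exact smul_mem_of_le hC h0 hc' hT ht

/-- Since v ≤ ū - x, a step closes at most the fraction 1/T of the gap to ū. -/
lemma apply_le (hrun : IsRun P μ p Ft C ubar T m₀ m δ ℱ z₀ b x g v) (hT : 1 ≤ T)
    {t : ℕ} (ht : t ≤ T) (ω : Ω) (i : Fin d) :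
    x t ω i ≤ (1 - (1 - (T : ℝ)⁻¹) ^ t) * ubar i := by
  have hT1 : (T : ℝ)⁻¹ ≤ 1 := inv_le_one_of_one_le₀ (by exact_mod_cast hT)
  have hT0 : (0 : ℝ) ≤ (T : ℝ)⁻¹ := by positivity
  induction t with
  | zero => simp [hrun.x_zero]
  | succ t ih =>
    have h1 := ih (by omega)
    have h2 := (hrun.v_mem t ht ω).2 i
    rw [hrun.x_succ t ht, PiLp.add_apply, PiLp.smul_apply, smul_eq_mul]
    calc x t ω i + (T : ℝ)⁻¹ * v t ω i ≤ x t ω i + (T : ℝ)⁻¹ * (ubar i - x t ω i) := by gcongr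
      _ = (1 - (T : ℝ)⁻¹) * x t ω i + (T : ℝ)⁻¹ * ubar i := by ring
      _ ≤ (1 - (T : ℝ)⁻¹) * ((1 - (1 - (T : ℝ)⁻¹) ^ t) * ubar i) + (T : ℝ)⁻¹ * ubar i := by
          gcongr
      _ = _ := by ring

lemma norm_sub_le (hrun : IsRun P μ p Ft C ubar T m₀ m δ ℱ z₀ b x g v)
    (hD : ∀ c ∈ C, ‖c‖ ≤ D) {t : ℕ} (ht : t < T) (ω : Ω) :
    ‖x (t + 1) ω - x t ω‖ ≤ D / T := by
  rw [hrun.x_succ t ht, add_sub_cancel_left, norm_smul, norm_inv, Real.norm_natCast,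
    div_eq_inv_mul]
  gcongr
  exact hD _ (hrun.v_mem t ht ω).1

lemma measurable_x (hrun : IsRun P μ p Ft C ubar T m₀ m δ ℱ z₀ b x g v) {t : ℕ} (ht : t ≤ T) :
    Measurable[ℱ t] (x t) := by
  induction t with
  | zero =>
    have : x 0 = fun _ => 0 := funext hrun.x_zero
    rw [this]
    exact measurable_const
  | succ t ih =>
    have : x (t + 1) = fun ω => x t ω + (T : ℝ)⁻¹ • v t ω := funext (hrun.x_succ t ht)
    rw [this]
    have h1 : Measurable[ℱ (t + 1)] (x t) := (ih (by omega)).mono (ℱ.mono (by omega)) le_rfl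
    have h2 := hrun.measurable_v t ht
    exact Measurable.add h1 (Measurable.const_smul h2 ((T : ℝ)⁻¹))

/-- The pair of the iterates `x t` and `x (t + 1)`. -/
noncomputable def stepPair (hrun : IsRun P μ p Ft C ubar T m₀ m δ ℱ z₀ b x g v)
    (hC : Convex ℝ C) (h0 : 0 ∈ C) (hT : 1 ≤ T) (hD : ∀ c ∈ C, ‖c‖ ≤ D) {t : ℕ} (ht : t < T)
    (ω : Ω) : StepPair C D T :=
  ⟨(x t ω, x (t + 1) ω), hrun.mem hC h0 hT ht.le ω, hrun.mem hC h0 hT ht ω,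
    hrun.norm_sub_le hD ht ω⟩

lemma measurable_stepPair (hrun : IsRun P μ p Ft C ubar T m₀ m δ ℱ z₀ b x g v)
    (hC : Convex ℝ C) (h0 : 0 ∈ C) (hT : 1 ≤ T) (hD : ∀ c ∈ C, ‖c‖ ≤ D) {t : ℕ} (ht : t < T) :
    Measurable[ℱ (t + 1)] (hrun.stepPair hC h0 hT hD ht) :=
  Measurable.subtype_mk (((hrun.measurable_x ht.le).mono (ℱ.mono (by omega)) le_rfl).prodMk
    (hrun.measurable_x ht))

lemma measurable_clampedEst (hrun : IsRun P μ p Ft C ubar T m₀ m δ ℱ z₀ b x g v)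
    (h : Regular μ p Ft C U D δ B G L L₂) (h0 : 0 ∈ C) (hT : 1 ≤ T) {t : ℕ} (ht : t < T) :
    Measurable[ℱ (t + 1)] (clampedEst δ p Ft b x (g 0) t) := by
  induction t with
  | zero =>
    have heq : clampedEst δ p Ft b x (g 0) 0
        = (fun z : Fin m₀ → Z => (m₀ : ℝ)⁻¹ • ∑ k, gradEst p Ft 0 (z k)) ∘ z₀ :=
      funext hrun.g_zero
    rw [heq]
    have hm : Measurable (gradEst p Ft 0) :=
      h.measurable_gradEst measurable_const measurable_id fun _ => h0
    exact Measurable.comp (by fun_prop) hrun.measurable_z₀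
  | succ t ih =>
    have ht' : t < T := by omega
    have h1 : Measurable[ℱ (t + 1 + 1)] (clampedEst δ p Ft b x (g 0) t) :=
      (ih ht').mono (ℱ.mono (by omega)) le_rfl
    have h2 : Measurable[ℱ (t + 1 + 1)] (hrun.stepPair h.convex h0 hT h.norm_le ht') :=
      (hrun.measurable_stepPair h.convex h0 hT h.norm_le ht').mono (ℱ.mono (by omega)) le_rfl
    have h3 := hrun.measurable_b t ht
    have hm := h.measurable_stepPair_stepEst hT
    have hsum : Measurable fun r : StepPair C D T × (Fin m → ℝ × Z) =>
        (m : ℝ)⁻¹ • ∑ k, stepEst δ p Ft r.1.1.1 r.1.1.2 (r.2 k) :=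
      (Finset.measurable_sum _ fun k _ => hm.comp (g := fun r : StepPair C D T × (ℝ × Z) =>
          stepEst δ p Ft r.1.1.1 r.1.1.2 r.2)
        (f := fun r : StepPair C D T × (Fin m → ℝ × Z) => (r.1, r.2 k))
        (by fun_prop)).const_smul ((m : ℝ)⁻¹)
    have h4 := hsum.comp (h2.prodMk h3)
    exact Measurable.add h1 h4

lemma ae_mem_Icc (hrun : IsRun P μ p Ft C ubar T m₀ m δ ℱ z₀ b x g v) [SFinite μ]
    (h : Regular μ p Ft C U D δ B G L L₂) (h0 : 0 ∈ C) (hT : 1 ≤ T) {t : ℕ} (ht : t + 1 < T) :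
    ∀ᵐ ω ∂P, ∀ k, (b (t + 1) ω k).1 ∈ Icc (0 : ℝ) 1 := by
  have hS : MeasurableSet {s : Fin m → ℝ × Z | ∀ k, (s k).1 ∈ Icc (0 : ℝ) 1}ᶜ := by
    refine MeasurableSet.compl ?_
    rw [ofPred_forall]
    exact MeasurableSet.iInter fun k =>
      (measurable_fst.comp (measurable_pi_apply k)) measurableSet_Icc
  have hlaw := hrun.law_b t ht univ MeasurableSet.univ _ hS
  have hzero : ∀ ω, (Measure.pi fun _ : Fin m => pairLaw μ p (x t ω) (x (t + 1) ω))
      {s : Fin m → ℝ × Z | ∀ k, (s k).1 ∈ Icc (0 : ℝ) 1}ᶜ = 0 := by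
    intro ω
    have := h.isProbabilityMeasure_pairLaw (hrun.mem h.convex h0 hT (by omega : t ≤ T) ω)
      (hrun.mem h.convex h0 hT ht.le ω)
    rw [← mem_ae_iff]
    exact ae_all_iff.2 fun k =>
      (measurePreserving_eval (fun _ : Fin m => pairLaw μ p (x t ω) (x (t + 1) ω))
        k).quasiMeasurePreserving.ae (ae_pairLaw_mem μ p _ _)
  simp only [hzero, lintegral_zero, univ_inter] at hlaw
  rw [ae_iff]
  exact hlaw

/-- Almost surely no sampled a needs clamping. The clamped estimates are measurable everywhere, so
the error analysis is carried out for them. -/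
lemma ae_eq_clampedEst (hrun : IsRun P μ p Ft C ubar T m₀ m δ ℱ z₀ b x g v) [SFinite μ]
    (h : Regular μ p Ft C U D δ B G L L₂) (h0 : 0 ∈ C) (hT : 1 ≤ T) {t : ℕ} (ht : t < T) :
    g t =ᵐ[P] clampedEst δ p Ft b x (g 0) t := by
  induction t with
  | zero => rfl
  | succ t ih =>
    filter_upwards [ih (by omega), hrun.ae_mem_Icc h h0 hT ht] with ω h1 h2
    rw [hrun.g_succ t ht, h1, clampedEst]
    congr 2
    refine Finset.sum_congr rfl fun k _ => ?_
    rw [stepEst, clampSeg_of_mem _ _ (h2 k)]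

lemma measurable_mk (hrun : IsRun P μ p Ft C ubar T m₀ m δ ℱ z₀ b x g v) (hC : Convex ℝ C)
    (h0 : 0 ∈ C) (hT : 1 ≤ T) {t : ℕ} (ht : t ≤ T) :
    Measurable[ℱ t] fun ω => (⟨x t ω, hrun.mem hC h0 hT ht ω⟩ : C) :=
  Measurable.subtype_mk (hrun.measurable_x ht)

lemma measurable_meanGrad (hrun : IsRun P μ p Ft C ubar T m₀ m δ ℱ z₀ b x g v) [SFinite μ]
    (h : Regular μ p Ft C U D δ B G L L₂) (h0 : 0 ∈ C) (hT : 1 ≤ T) {t : ℕ} (ht : t ≤ T) :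
    Measurable[ℱ t] fun ω => meanGrad μ p Ft (x t ω) := by
  have hx := hrun.measurable_mk h.convex h0 hT ht
  have hcomp := h.measurable_meanGrad.comp hx
  simp only [Function.comp_def] at hcomp
  exact hcomp

/-- The mean square error of the gradient estimates. -/
lemma lintegral_error_le (hrun : IsRun P μ p Ft C ubar T m₀ m δ ℱ z₀ b x g v) [SFinite μ]
    [IsProbabilityMeasure P] (h : Regular μ p Ft C U D δ B G L L₂) (h0 : 0 ∈ C) (hT : 1 ≤ T)
    (hm₀ : 1 ≤ m₀) (hm : 2 * T ≤ m) (hδ : 3 * (1 + B) * L₂ * D * δ ≤ Lbar B G L)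
    {V : ℝ} (hV0 : 0 ≤ V)
    (hV : ∫⁻ z, ‖gradEst p Ft 0 z‖ₑ ^ 2 ∂(sampleLaw μ p 0) ≤ ENNReal.ofReal V)
    (hVm : V * (T : ℝ) ^ 2 ≤ m₀ * (Lbar B G L ^ 2 * D ^ 2)) {t : ℕ} (ht : t < T) :
    ∫⁻ ω, ‖clampedEst δ p Ft b x (g 0) t ω - meanGrad μ p Ft (x t ω)‖ₑ ^ 2 ∂P
      ≤ ENNReal.ofReal ((1 + 3 * t / T) * (Lbar B G L * D / T) ^ 2) := by
  have hT0 : (0 : ℝ) < T := by positivity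
  have hm₀' : (0 : ℝ) < m₀ := by positivity
  set A := Lbar B G L * D / T with hA
  induction t with
  | zero =>
    have := h.prob 0 h0
    have hmeas : Measurable (gradEst p Ft 0) :=
      h.measurable_gradEst measurable_const measurable_id fun _ => h0
    have heq : ∀ ω, clampedEst δ p Ft b x (g 0) 0 ω - meanGrad μ p Ft (x 0 ω)
        = -meanGrad μ p Ft 0 + (m₀ : ℝ)⁻¹ • ∑ k, gradEst p Ft 0 (z₀ ω k) := by
      intro ω
      rw [clampedEst, hrun.g_zero, hrun.x_zero]
      abel
    simp only [heq]
    have hφ : Measurable fun s : Fin m₀ → Z =>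
        ‖-meanGrad μ p Ft 0 + (m₀ : ℝ)⁻¹ • ∑ k, gradEst p Ft 0 (s k)‖ₑ ^ 2 := by fun_prop
    have hz : Measurable z₀ := hrun.measurable_z₀.mono (ℱ.le 1) le_rfl
    rw [← lintegral_map hφ hz, hrun.law_z₀]
    refine (lintegral_pi_average_le hm₀ _ hmeas hV0 hV _).trans (ENNReal.ofReal_le_ofReal ?_)
    -- The initial error has mean zero, so only V/m₀ remains, and `hVm` bounds it by A².
    have h1 : -meanGrad μ p Ft 0 + ∫ z, gradEst p Ft 0 z ∂(sampleLaw μ p 0) = 0 := by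
      rw [meanGrad, neg_add_cancel]
    rw [h1, norm_zero, zero_pow two_ne_zero, zero_add, Nat.cast_zero, mul_zero, zero_div,
      add_zero, one_mul, hA, div_pow, mul_pow, div_le_div_iff₀ hm₀' (by positivity)]
    linarith
  | succ t ih =>
    have ht' : t < T := by omega
    have ih := ih ht'
    -- Y collects all that the next error needs from the past. It is measurable for `ℱ (t + 1)`, so
    -- its preimages are admissible events in `law_b`.
    let Y : Ω → StepPair C D T × Vec d := fun ω =>
      (hrun.stepPair h.convex h0 hT h.norm_le ht' ω,
        clampedEst δ p Ft b x (g 0) t ω - meanGrad μ p Ft (x t ω))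
    have hYm : Measurable[ℱ (t + 1)] Y :=
      (hrun.measurable_stepPair h.convex h0 hT h.norm_le ht').prodMk
        ((hrun.measurable_clampedEst h h0 hT ht').sub
          ((hrun.measurable_meanGrad h h0 hT ht'.le).mono (ℱ.mono (by omega)) le_rfl))
    have hY : Measurable Y := hYm.mono (ℱ.le _) le_rfl
    have hb : Measurable (b (t + 1)) := (hrun.measurable_b t ht).mono (ℱ.le _) le_rfl
    let κ : StepPair C D T × Vec d → Measure (Fin m → ℝ × Z) := fun w =>
      Measure.pi fun _ => pairLaw μ p w.1.1.1 w.1.1.2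
    have hprob : ∀ w : StepPair C D T × Vec d,
        IsProbabilityMeasure (pairLaw μ p w.1.1.1 w.1.1.2) := fun w =>
      h.isProbabilityMeasure_pairLaw w.1.2.1 w.1.2.2.1
    have hκ : Measurable κ :=
      measurable_measure_pi (κ := fun w : StepPair C D T × Vec d =>
        pairLaw μ p w.1.1.1 w.1.1.2) ((h.measurable_pairLaw T).comp measurable_fst)
    have hκp : ∀ w, IsProbabilityMeasure (κ w) := fun w => by
      have := hprob w
      exact inferInstanceAs (IsProbabilityMeasure (Measure.pi _))
    have hlaw := lintegral_comp_of_condLaw P hY hb hκ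
      (fun S hS S' hS' => hrun.law_b t ht _ (hYm hS) S' hS')
      (h.measurable_stepError (m := m) hT)
    have heq : ∀ ω, ‖clampedEst δ p Ft b x (g 0) (t + 1) ω
        - meanGrad μ p Ft (x (t + 1) ω)‖ₑ ^ 2 = stepError μ δ p Ft (Y ω, b (t + 1) ω) := by
      intro ω
      simp only [stepError, Y, stepPair, clampedEst]
      congr 2
      abel
    simp only [heq]
    rw [hlaw]
    have hstep : ∀ ω, ∫⁻ s, stepError μ δ p Ft (Y ω, s) ∂κ (Y ω) ≤ ENNReal.ofReal (1 + (4 * T : ℝ)⁻¹)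
        * ‖clampedEst δ p Ft b x (g 0) t ω - meanGrad μ p Ft (x t ω)‖ₑ ^ 2
        + ENNReal.ofReal (13 / 9 * A ^ 2 / T) := by
      intro ω
      refine (h.lintegral_step_le hT hm hδ (Y ω).1.2.1 (Y ω).1.2.2.1 (Y ω).1.2.2.2
        (Y ω).2).trans (le_of_eq ?_)
      rw [ENNReal.ofReal_add (by positivity) (by positivity),
        ENNReal.ofReal_mul (by positivity), ENNReal.ofReal_pow (norm_nonneg _), ofReal_norm]
    refine (lintegral_mono hstep).trans ?_
    rw [lintegral_add_right _ measurable_const, lintegral_const_mul' _ _ ENNReal.ofReal_ne_top,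
      lintegral_const, measure_univ, mul_one]
    calc _ ≤ ENNReal.ofReal (1 + (4 * T : ℝ)⁻¹) * ENNReal.ofReal ((1 + 3 * t / T) * A ^ 2)
          + ENNReal.ofReal (13 / 9 * A ^ 2 / T) := by gcongr
      _ ≤ _ := by
          rw [← ENNReal.ofReal_mul (by positivity),
            ← ENNReal.ofReal_add (by positivity) (by positivity)]
          refine ENNReal.ofReal_le_ofReal ?_
          have h3 : 3 * (t : ℝ) / T ≤ 3 := by
            rw [div_le_iff₀ hT0]
            have : (t : ℝ) ≤ T := by exact_mod_cast ht'.le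
            linarith
          -- As 1 + 3t/T ≤ 4, the growth factor adds at most A²/T; with 13A²/(9T) this is 22A²/(9T),
          -- within the allowance 3A²/T.
          have h4 : (4 * T : ℝ)⁻¹ * (1 + 3 * t / T) ≤ (4 * T : ℝ)⁻¹ * 4 := by
            gcongr
            linarith
          have h5 : (4 * T : ℝ)⁻¹ * 4 = 1 / T := by field_simp
          have h6 : 3 * ((t + 1 : ℕ) : ℝ) / T = 3 * t / T + 3 / T := by
            push_cast
            ring
          have h7 : 1 / (T : ℝ) + 13 / 9 * (1 / T) ≤ 3 / T := by
            rw [← sub_nonneg]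
            have : 3 / (T : ℝ) - (1 / T + 13 / 9 * (1 / T)) = 5 / 9 * (1 / T) := by ring
            rw [this]
            positivity
          calc _ = (1 + 3 * t / T + (4 * T : ℝ)⁻¹ * (1 + 3 * t / T) + 13 / 9 * (1 / T)) * A ^ 2 := by
                ring
            _ ≤ _ := mul_le_mul_of_nonneg_right (by linarith) (sq_nonneg A)

end IsRun

end

/-! ### The recursion for the mean objective and the constant e⁻¹. -/

section

/-- For T = n + 1 with n ≥ 1 the base is (1 + 1/n)⁻¹ ≥ e^{-1/n}, raised to the power n. For T = 1
the right side is 0⁰ = 1. -/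
lemma exp_neg_one_le_pow {T : ℕ} (hT : 1 ≤ T) :
    Real.exp (-1) ≤ (1 - (T : ℝ)⁻¹) ^ (T - 1) := by
  obtain ⟨n, rfl⟩ : ∃ n, T = n + 1 := ⟨T - 1, by omega⟩
  rcases n.eq_zero_or_pos with rfl | hn
  · simp
  have hn' : (0 : ℝ) < n := by positivity
  have h1 : 1 - (((n + 1 : ℕ) : ℝ))⁻¹ = (1 + (n : ℝ)⁻¹)⁻¹ := by
    push_cast
    field_simp
    ring
  have h2 : Real.exp (-(n : ℝ)⁻¹) ≤ (1 + (n : ℝ)⁻¹)⁻¹ := by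
    rw [Real.exp_neg]
    gcongr
    rw [add_comm]
    exact Real.add_one_le_exp _
  rw [h1, Nat.add_sub_cancel]
  calc Real.exp (-1) = Real.exp (-(n : ℝ)⁻¹) ^ n := by
        rw [← Real.exp_nat_mul]
        congr 1
        field_simp
    _ ≤ _ := by gcongr

/-- The recursion for the mean objective values. -/
lemma le_of_recursion {a : ℕ → ℝ} {T : ℕ} (hT : 1 ≤ T) {M K : ℝ} (hK : 0 ≤ K) (h0 : 0 ≤ a 0)
    (hstep : ∀ t < T, (1 - (T : ℝ)⁻¹) * a t + (T : ℝ)⁻¹ * ((1 - (T : ℝ)⁻¹) ^ t * M) - K / T ^ 2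
      ≤ a (t + 1)) {t : ℕ} (ht : t ≤ T) :
    (t : ℝ) / T * ((1 - (T : ℝ)⁻¹) ^ (t - 1) * M) - t * (K / T ^ 2) ≤ a t := by
  have hT1 : 0 ≤ 1 - (T : ℝ)⁻¹ := sub_nonneg.2 (inv_le_one_of_one_le₀ (by exact_mod_cast hT))
  have hTi : 0 ≤ (T : ℝ)⁻¹ := by positivity
  induction t with
  | zero => simpa using h0
  | succ t ih =>
    refine le_trans ?_ (hstep t ht)
    have h1 := mul_le_mul_of_nonneg_left (ih (by omega)) hT1
    -- The factor 1 - 1/T raises the exponent t - 1 to t. At t = 0 the subtraction is truncated, but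
    -- the coefficient t/T vanishes.
    have h2 : (1 - (T : ℝ)⁻¹) * ((t : ℝ) / T * ((1 - (T : ℝ)⁻¹) ^ (t - 1) * M))
        = (t : ℝ) / T * ((1 - (T : ℝ)⁻¹) ^ t * M) := by
      rcases t.eq_zero_or_pos with rfl | hpos
      · simp
      · obtain ⟨n, rfl⟩ : ∃ n, t = n + 1 := ⟨t - 1, by omega⟩
        rw [Nat.add_sub_cancel, pow_succ]
        ring
    have h3 : 0 ≤ (T : ℝ)⁻¹ * (t * (K / T ^ 2)) := by positivity
    rw [mul_sub, h2] at h1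
    rw [Nat.add_sub_cancel]
    push_cast
    rw [add_div, add_mul, add_mul, one_mul, one_div]
    linarith

namespace IsRun

variable {d : ℕ} {Z : Type*} [MeasurableSpace Z]
  {μ : Measure Z} {p Ft : Vec d → Z → ℝ} {C U : Set (Vec d)} {ubar : Vec d}
  {D δ B G L L₂ : ℝ} {T m₀ m : ℕ} {Ω : Type*} [MeasurableSpace Ω] {P : Measure Ω}
  {ℱ : Filtration ℕ (inferInstance : MeasurableSpace Ω)}
  {z₀ : Ω → Fin m₀ → Z} {b : ℕ → Ω → Fin m → ℝ × Z} {x g v : ℕ → Ω → Vec d}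

lemma integrable_objective (hrun : IsRun P μ p Ft C ubar T m₀ m δ ℱ z₀ b x g v) [SFinite μ]
    [IsProbabilityMeasure P] (h : Regular μ p Ft C U D δ B G L L₂) (h0 : 0 ∈ C) (hT : 1 ≤ T)
    {t : ℕ} (ht : t ≤ T) : Integrable (fun ω => objective μ p Ft (x t ω)) P := by
  have hx := (hrun.measurable_mk h.convex h0 hT ht).mono (ℱ.le t) le_rfl
  have hcomp := h.measurable_objective.comp hx
  simp only [Function.comp_def] at hcomp
  exact .of_bound hcomp.aestronglyMeasurable B
    (.of_forall fun ω => h.abs_objective_le (hrun.mem h.convex h0 hT ht ω))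

lemma integral_norm_error_le (hrun : IsRun P μ p Ft C ubar T m₀ m δ ℱ z₀ b x g v) [SFinite μ]
    [IsProbabilityMeasure P] (h : Regular μ p Ft C U D δ B G L L₂) (h0 : 0 ∈ C) (hT : 1 ≤ T)
    (hm₀ : 1 ≤ m₀) (hm : 2 * T ≤ m) (hδ : 3 * (1 + B) * L₂ * D * δ ≤ Lbar B G L)
    {V : ℝ} (hV0 : 0 ≤ V)
    (hV : ∫⁻ z, ‖gradEst p Ft 0 z‖ₑ ^ 2 ∂(sampleLaw μ p 0) ≤ ENNReal.ofReal V)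
    (hVm : V * (T : ℝ) ^ 2 ≤ m₀ * (Lbar B G L ^ 2 * D ^ 2)) {t : ℕ} (ht : t < T) :
    Integrable (fun ω => ‖g t ω - meanGrad μ p Ft (x t ω)‖) P ∧
      ∫ ω, ‖g t ω - meanGrad μ p Ft (x t ω)‖ ∂P ≤ 2 * (Lbar B G L * D / T) := by
  have hT0 : (0 : ℝ) < T := by positivity
  have hA : 0 ≤ Lbar B G L * D / T :=
    div_nonneg (mul_nonneg (Regular.Lbar_nonneg B G L) h.D_nonneg) hT0.le
  set e : Ω → Vec d := fun ω => clampedEst δ p Ft b x (g 0) t ω - meanGrad μ p Ft (x t ω) with he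
  have hm1 : Measurable e :=
    ((hrun.measurable_clampedEst h h0 hT ht).mono (ℱ.le _) le_rfl).sub
      ((hrun.measurable_meanGrad h h0 hT ht.le).mono (ℱ.le _) le_rfl)
  have hle : ∫⁻ ω, ‖e ω‖ₑ ^ 2 ∂P ≤ ENNReal.ofReal ((2 * (Lbar B G L * D / T)) ^ 2) := by
    refine (hrun.lintegral_error_le h h0 hT hm₀ hm hδ hV0 hV hVm ht).trans
      (ENNReal.ofReal_le_ofReal ?_)
    have h3 : 3 * (t : ℝ) / T ≤ 3 := by
      rw [div_le_iff₀ hT0]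
      have : (t : ℝ) ≤ T := by exact_mod_cast ht.le
      linarith
    calc (1 + 3 * (t : ℝ) / T) * (Lbar B G L * D / T) ^ 2
        ≤ 4 * (Lbar B G L * D / T) ^ 2 := by
          gcongr
          linarith
      _ = _ := by ring
  have hae : (fun ω => ‖e ω‖) =ᵐ[P] fun ω => ‖g t ω - meanGrad μ p Ft (x t ω)‖ := by
    filter_upwards [hrun.ae_eq_clampedEst h h0 hT ht] with ω hω
    rw [he, hω]
  constructor
  · exact (((memLp_two_of_lintegral_le hm1.aestronglyMeasurable hle).integrable
      one_le_two).norm).congr hae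
  · rw [← integral_congr_ae hae]
    exact integral_norm_le_of_lintegral_sq_le hm1.aestronglyMeasurable (by positivity) hle

/-- The convergence guarantee for a regular model. -/
lemma integral_objective_ge (hrun : IsRun P μ p Ft C ubar T m₀ m δ ℱ z₀ b x g v) [SFinite μ]
    [IsProbabilityMeasure P] (h : Regular μ p Ft C U D δ B G L L₂) (h0 : 0 ∈ C) (hT : 1 ≤ T)
    (hF : DRSubmodularOn (objective μ p Ft) (box ubar))
    (hF0 : ∀ x ∈ box ubar, 0 ≤ objective μ p Ft x) (hC : C ⊆ box ubar) (hdown : DownClosed C)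
    (hm₀ : 1 ≤ m₀) (hm : 2 * T ≤ m) (hδ : 3 * (1 + B) * L₂ * D * δ ≤ Lbar B G L)
    {V : ℝ} (hV0 : 0 ≤ V)
    (hV : ∫⁻ z, ‖gradEst p Ft 0 z‖ₑ ^ 2 ∂(sampleLaw μ p 0) ≤ ENNReal.ofReal V)
    (hVm : V * (T : ℝ) ^ 2 ≤ m₀ * (Lbar B G L ^ 2 * D ^ 2)) {xs : Vec d} (hxs : xs ∈ C) :
    Real.exp (-1) * objective μ p Ft xs - (2 * √2 + 0.5) * Lbar B G L * D ^ 2 / T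
      ≤ ∫ ω, objective μ p Ft (x T ω) ∂P := by
  have hT0 : (0 : ℝ) < T := by positivity
  have hLb := Regular.Lbar_nonneg B G L
  have hD := h.D_nonneg
  have hT1 : 0 ≤ 1 - (T : ℝ)⁻¹ := sub_nonneg.2 (inv_le_one_of_one_le₀ (by exact_mod_cast hT))
  have hT2 : 1 - (T : ℝ)⁻¹ ≤ 1 := sub_le_self _ (by positivity)
  set K := (2 * √2 + 0.5) * Lbar B G L * D ^ 2 with hK
  have hstep : ∀ t < T, (1 - (T : ℝ)⁻¹) * ∫ ω, objective μ p Ft (x t ω) ∂P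
      + (T : ℝ)⁻¹ * ((1 - (T : ℝ)⁻¹) ^ t * objective μ p Ft xs) - K / T ^ 2
      ≤ ∫ ω, objective μ p Ft (x (t + 1) ω) ∂P := by
    intro t ht
    obtain ⟨hei, hele⟩ := hrun.integral_norm_error_le h h0 hT hm₀ hm hδ hV0 hV hVm ht
    have hint := hrun.integrable_objective h h0 hT ht.le
    have hpt : ∀ ω, (1 - (T : ℝ)⁻¹) * objective μ p Ft (x t ω)
        + (T : ℝ)⁻¹ * ((1 - (T : ℝ)⁻¹) ^ t * objective μ p Ft xs)
        - (T : ℝ)⁻¹ * (√2 * D * ‖g t ω - meanGrad μ p Ft (x t ω)‖)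
        - Lbar B G L * D ^ 2 / (2 * T ^ 2) ≤ objective μ p Ft (x (t + 1) ω) := by
      intro ω
      -- The choice θ = 1 - (1 - 1/T)^t is the coordinatewise bound on x^t, so that 1 - θ is the
      -- weight of F(x*).
      have := h.objective_step_ge hF hF0 hC hdown hT (hrun.mem h.convex h0 hT ht.le ω) hxs
        (hrun.v_mem t ht ω).1 (fun w hw => hrun.add_smul_mem h.convex h0 hT ht ω hw)
        (hrun.v_max t ht ω) (θ := 1 - (1 - (T : ℝ)⁻¹) ^ t)
        (sub_nonneg.2 (pow_le_one₀ hT1 hT2)) (sub_le_self _ (pow_nonneg hT1 t))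
        (hrun.apply_le hT ht.le ω)
      rwa [sub_sub_cancel, ← hrun.x_succ t ht] at this
    have hi1 : Integrable (fun ω => (1 - (T : ℝ)⁻¹) * objective μ p Ft (x t ω)
        + (T : ℝ)⁻¹ * ((1 - (T : ℝ)⁻¹) ^ t * objective μ p Ft xs)) P :=
      (hint.const_mul _).add (integrable_const _)
    have hi2 : Integrable (fun ω => (T : ℝ)⁻¹ *
        (√2 * D * ‖g t ω - meanGrad μ p Ft (x t ω)‖)) P := (hei.const_mul _).const_mul _
    have hi3 : Integrable (fun ω => (1 - (T : ℝ)⁻¹) * objective μ p Ft (x t ω)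
        + (T : ℝ)⁻¹ * ((1 - (T : ℝ)⁻¹) ^ t * objective μ p Ft xs)
        - (T : ℝ)⁻¹ * (√2 * D * ‖g t ω - meanGrad μ p Ft (x t ω)‖)) P := hi1.sub hi2
    have hmono := integral_mono (hi3.sub (integrable_const _))
      (hrun.integrable_objective h h0 hT (t := t + 1) ht) hpt
    simp only [Pi.sub_apply] at hmono
    rw [integral_sub hi3 (integrable_const _), integral_sub hi1 hi2,
      integral_add (hint.const_mul _) (integrable_const _)] at hmono
    simp only [integral_const_mul, integral_const, probReal_univ, one_smul] at hmono
    have herr : (T : ℝ)⁻¹ * (√2 * D * ∫ ω, ‖g t ω - meanGrad μ p Ft (x t ω)‖ ∂P)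
        ≤ (T : ℝ)⁻¹ * (√2 * D * (2 * (Lbar B G L * D / T))) := by gcongr
    have hKeq : K / T ^ 2 = (T : ℝ)⁻¹ * (√2 * D * (2 * (Lbar B G L * D / T)))
        + Lbar B G L * D ^ 2 / (2 * T ^ 2) := by
      rw [hK]
      field_simp
      ring
    linarith
  have hx0 : 0 ≤ ∫ ω, objective μ p Ft (x 0 ω) ∂P :=
    integral_nonneg fun ω => hF0 _ (hC (hrun.mem h.convex h0 hT (Nat.zero_le T) ω))
  have hfinal := le_of_recursion hT (by positivity : 0 ≤ K) hx0 hstep le_rfl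
  refine le_trans ?_ hfinal
  have hexp := mul_le_mul_of_nonneg_right (exp_neg_one_le_pow hT) (hF0 xs (hC hxs))
  have h1 : (T : ℝ) / T = 1 := div_self hT0.ne'
  have h2 : (T : ℝ) * (K / T ^ 2) = K / T := by field_simp
  rw [h1, h2, one_mul]
  linarith

end IsRun

end

end SMCG

/-! ### The theorem, reduced to a regular model. -/

theorem mainTheorem2 {d : ℕ} {Z : Type*} [MeasurableSpace Z] (μ : Measure Z) [SigmaFinite μ]
    -- the densities `p(z ; x)` and the stochastic functions `Ft(x ; z)`
    (p Ft : SMCG.Vec d → Z → ℝ)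
    (hp_meas : Measurable (Function.uncurry p)) (hFt_meas : Measurable (Function.uncurry Ft))
    -- the feasible set
    (ubar : SMCG.Vec d) (C : Set (SMCG.Vec d))
    (hC_box : C ⊆ SMCG.box ubar) (hC_compact : IsCompact C) (hC_convex : Convex ℝ C)
    (hC_down : SMCG.DownClosed C) (D : ℝ) (hD : ∀ x ∈ C, ‖x‖ ≤ D)
    -- the objective is well defined, nonnegative and DR-submodular on the box
    (hp_nonneg : ∀ x ∈ SMCG.box ubar, ∀ z, 0 ≤ p x z)
    (hp_prob : ∀ x ∈ SMCG.box ubar, IsProbabilityMeasure (SMCG.sampleLaw μ p x))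
    (hFt_int : ∀ x ∈ SMCG.box ubar, Integrable (Ft x) (SMCG.sampleLaw μ p x))
    (hF_nonneg : ∀ x ∈ SMCG.box ubar, 0 ≤ SMCG.objective μ p Ft x)
    (hF_DR : SMCG.DRSubmodularOn (SMCG.objective μ p Ft) (SMCG.box ubar))
    -- regularity on an open set `U` that contains the closed `δ D`-neighbourhood of `C`
    (U : Set (SMCG.Vec d)) (hU : IsOpen U) (δ : ℝ) (hδ : 0 ≤ δ)
    (hδU : ∀ c ∈ C, Metric.closedBall c (δ * D) ⊆ U)
    (hp_pos : ∀ x ∈ U, ∀ z, 0 < p x z)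
    (hFt_C2 : ∀ z, ContDiffOn ℝ 2 (fun x => Ft x z) U)
    (hp_C2 : ∀ z, ContDiffOn ℝ 2 (fun x => p x z) U)
    -- bounded values, gradients and Hessians
    (B G L L₂ : ℝ)
    (hB : ∀ x ∈ C, ∀ z, |Ft x z| ≤ B)
    (hG_Ft : ∀ x ∈ C, ∀ z, ‖SMCG.gradF Ft x z‖ ≤ G)
    (hG_p : ∀ x ∈ C, ∫⁻ z, ‖SMCG.gradF (SMCG.logDensity p) x z‖ₑ ^ 4 ∂(SMCG.sampleLaw μ p x)
      ≤ ENNReal.ofReal (G ^ 4))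
    (hL_Ft : ∀ x ∈ C, ∀ z, ‖SMCG.hessF Ft x z‖ ≤ L)
    (hL_p : ∀ x ∈ C, ∫⁻ z, ‖SMCG.hessF (SMCG.logDensity p) x z‖ₑ ^ 2 ∂(SMCG.sampleLaw μ p x)
      ≤ ENNReal.ofReal (L ^ 2))
    -- Lipschitz continuity of the Hessians on the closed `δ D`-neighbourhood of `C`
    (hL₂_Ft : ∀ c₁ ∈ C, ∀ c₂ ∈ C, ∀ x ∈ Metric.closedBall c₁ (δ * D),
      ∀ y ∈ Metric.closedBall c₂ (δ * D), ∀ z,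
        ‖SMCG.hessF Ft x z - SMCG.hessF Ft y z‖ ≤ L₂ * ‖x - y‖)
    (hL₂_p : ∀ c₁ ∈ C, ∀ c₂ ∈ C, ∀ x ∈ Metric.closedBall c₁ (δ * D),
      ∀ y ∈ Metric.closedBall c₂ (δ * D), ∀ z,
        ‖SMCG.hessF (SMCG.logDensity p) x z - SMCG.hessF (SMCG.logDensity p) y z‖
          ≤ L₂ * ‖x - y‖)
    -- the parameters of the algorithm
    (T m₀ m : ℕ) (hT : 1 ≤ T) (hm₀ : 1 ≤ m₀)
    (hm₀_size : (1 + B) ^ 2 * G ^ 2 * (T : ℝ) ^ 2 ≤ m₀ * (SMCG.Lbar B G L ^ 2 * D ^ 2) ∨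
      ((∫⁻ z, ‖SMCG.gradEst p Ft 0 z‖ₑ ^ 2 ∂(SMCG.sampleLaw μ p 0) ≤ ENNReal.ofReal (G ^ 2)) ∧
        G ^ 2 * (T : ℝ) ^ 2 ≤ m₀ * (SMCG.Lbar B G L ^ 2 * D ^ 2)))
    (hm_size : 2 * T ≤ m)
    (hδ_small : 3 * (1 + B) * L₂ * D * δ ≤ SMCG.Lbar B G L)
    -- a run of the algorithm
    {Ω : Type*} [MeasurableSpace Ω] (P : Measure Ω) [IsProbabilityMeasure P]
    (ℱ : Filtration ℕ (inferInstance : MeasurableSpace Ω))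
    (z₀ : Ω → Fin m₀ → Z) (b : ℕ → Ω → Fin m → ℝ × Z) (x g v : ℕ → Ω → SMCG.Vec d)
    (hrun : SMCG.IsRun P μ p Ft C ubar T m₀ m δ ℱ z₀ b x g v)
    -- a global maximizer
    (xs : SMCG.Vec d) (hxs : xs ∈ C) (hmax : IsMaxOn (SMCG.objective μ p Ft) C xs) :
    (∀ ω, x T ω ∈ C) ∧
    Integrable (fun ω => SMCG.objective μ p Ft (x T ω)) P ∧
    Real.exp (-1) * SMCG.objective μ p Ft xs
        - (2 * Real.sqrt 2 + 0.5) * SMCG.Lbar B G L * D ^ 2 / T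
      ≤ ∫ ω, SMCG.objective μ p Ft (x T ω) ∂P := by
  have h0 : (0 : SMCG.Vec d) ∈ C :=
    hC_down xs hxs 0 fun i => ⟨le_rfl, (hC_box hxs i).1⟩
  have hprob0 := hp_prob 0 (hC_box h0)
  -- A probability law needs a sample point z; the bounds at (0; z) then force B, G and L to be
  -- nonnegative.
  obtain ⟨z⟩ := (SMCG.sampleLaw μ p 0).nonempty_of_neZero
  have hD0 : 0 ≤ D := (norm_nonneg _).trans (hD 0 h0)
  have hB0 : 0 ≤ B := (abs_nonneg _).trans (hB 0 h0 z)
  -- The sign of L₂ is not prescribed. Replacing it by max(L₂, 0) weakens the Lipschitz bounds and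
  -- preserves the smallness condition, as L̄ ≥ 0.
  have hLmax : ∀ r : ℝ, 0 ≤ r → L₂ * r ≤ max L₂ 0 * r := fun r hr =>
    mul_le_mul_of_nonneg_right (le_max_left _ _) hr
  have hself : ∀ c ∈ C, c ∈ Metric.closedBall c (δ * D) := fun c _ =>
    Metric.mem_closedBall_self (mul_nonneg hδ hD0)
  have h : SMCG.Regular μ p Ft C U D δ B G L (max L₂ 0) :=
    { smooth_Ft := ⟨hU, hFt_meas, hFt_C2⟩
      smooth_p := ⟨hU, hp_meas, hp_C2⟩
      pos := hp_pos
      convex := hC_convex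
      norm_le := hD
      δ_nonneg := hδ
      D_nonneg := hD0
      B_nonneg := hB0
      G_nonneg := (norm_nonneg _).trans (hG_Ft 0 h0 z)
      L_nonneg := (norm_nonneg _).trans (hL_Ft 0 h0 z)
      L₂_nonneg := le_max_right _ _
      ball := hδU
      prob := fun x hx => hp_prob x (hC_box hx)
      Ft_le := hB
      grad_Ft_le := hG_Ft
      grad_p_le := hG_p
      hess_Ft_le := hL_Ft
      hess_p_le := hL_p
      lip_Ft := fun c hc y hy z =>
        (hL₂_Ft c hc c hc y hy c (hself c hc) z).trans (hLmax _ (norm_nonneg _))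
      lip_p := fun c hc y hy z =>
        (hL₂_p c hc c hc y hy c (hself c hc) z).trans (hLmax _ (norm_nonneg _)) }
  have hδ' : 3 * (1 + B) * max L₂ 0 * D * δ ≤ SMCG.Lbar B G L := by
    rcases le_total 0 L₂ with hL | hL
    · rwa [max_eq_left hL]
    · rw [max_eq_right hL]
      simpa using SMCG.Regular.Lbar_nonneg B G L
  refine ⟨hrun.mem hC_convex h0 hT le_rfl, hrun.integrable_objective h h0 hT le_rfl, ?_⟩
  rcases hm₀_size with hsize | ⟨hvar, hsize⟩
  · exact hrun.integral_objective_ge h h0 hT hF_DR hF_nonneg hC_box hC_down hm₀ hm_size hδ'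
      (by positivity) (h.lintegral_gradEst_le h0) hsize hxs
  · exact hrun.integral_objective_ge h h0 hT hF_DR hF_nonneg hC_box hC_down hm₀ hm_size hδ'
      (by positivity) hvar hsize hxs
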